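/- **Setting.** Let $\mathcal P=(\mathcal P,d,\mu)$ be a metric space with a non-atomic Borel regular measure $\mu$ such that $0<\mu(B)<\infty$ for every ball $B=B(x,r)$, $r>0$ (so $\mu$ is $\sigma$-finite). Assume that $\mu$ is doubling: there is $C\ge 1$ with $\mu(B(x,2r))\le C\,\mu(B(x,r))$ for all $x\in\mathcal P$, $r>0$. Let $\mathcal M$ be the set of all $\mu$-measurable functions $u:\mathcal P\to[-\infty,\infty]$, defined everywhere. **Upper gradients.** A Borel function $g:\mathcal P\to[0,\infty]$ is an *upper gradient* of $u:\mathcal P\to[-\infty,\infty]$ if $|u(\gamma(0))-u(\gamma(l))|\le\int_0^{l} g(\gamma(t))\,dt$ for every non-constant rectifiable curve $\gamma:[0,l]\to\mathcal P$ parametrized by arc length, where $|(\pm\infty)-(\pm\infty)|=\infty$. **Poincaré inequality.** $\mathcal P$ is a *$1$-Poincaré space* if there are $c>0$ and $\lambda\ge1$ such that $$\frac1{\mu(B)}\int_B|u-u_B|\,d\mu\le c\,\operatorname{diam}(B)\,\frac1{\mu(\lambda B)}\int_{\lambda B}g\,d\mu ,\qquad u_B=\frac1{\mu(B)}\int_B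 u\,d\mu,$$ for all balls $B=B(x,r)$ (with $\lambda B=B(x,\lambda r)$), all $u\in\mathcal M$ that are integrable on every ball, and all upper gradients $g$ of $u$. **Function spaces.** A *rearrangement-invariant Banach function space* is $X=\{u\in\mathcal M:\|u\|_X<\infty\}$ with a functional $\|\cdot\|_X:\mathcal M\to[0,\infty]$ such that for all $u,v,u_n\in\mathcal M$, $a\in\mathbb R$ and all measurable sets $E$: - $\|u\|_X=0$ if and only if $u=0$ a.e.; $\|au\|_X=|a|\,\|u\|_X$; $\|u+v\|_X\le\|u\|_X+\|v\|_X$; - if $|u|\le|v|$ a.e., then $\|u\|_X\le\|v\|_X$; - if $u_n\ge0$ a.e. for all $n$, then $\|\sum_n u_n\|_X\le\sum_n\|u_n\|_X$; - if $0\le u_n\uparrow u$ a.e., then $\|u_n\|_X\uparrow\|u\|_X$; - if $\mu(E)<\infty$, then $\|\chi_E\|_X<\infty$; - if $\mu(E)<\infty$, then there is $C_E>0$ with $\int_E|w|\,d\mu\le C_E\|w\|_X$ for all $w\in\mathcal M$; - if $\mu(\{|u|>t\})=\mu(\{|v|>t\})$ for all $t\ge0$, then $\|u\|_X=\|v\|_X$.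 Its norm is *absolutely continuous* if, for every $u\in X$, $\|u\chi_{E_n}\|_X\to0$ whenever $(E_n)$ is a decreasing sequence of measurable sets with $\mu(\bigcap_nE_n)=0$. **Newtonian space.** For $u\in\mathcal M$ put $\|u\|_{N^1X}=\|u\|_X+\inf_g\|g\|_X$, the infimum over all upper gradients $g$ of $u$, and $N^1X=\{u\in\mathcal M:\|u\|_{N^1X}<\infty\}$. **Theorem.** If $\mathcal P$ is a $1$-Poincaré space and $X$ is a rearrangement-invariant Banach function space over $(\mathcal P,\mu)$ with absolutely continuous norm, then Lipschitz functions are dense in $N^1X$: for every $u\in N^1X$ and every $\varepsilon>0$ there is a Lipschitz function $f:\mathcal P\to\mathbb R$ with $f\in N^1X$ and $\|u-f\|_{N^1X}<\varepsilon$. -/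

import Mathlib

open MeasureTheory Filter Topology Set
open scoped ENNReal NNReal

namespace NewtonianLip

variable {P : Type*} [MetricSpace P] [MeasurableSpace P]

/-! Extended real-valued `μ`-measurable functions are functions `u : P → EReal` with
`AEMeasurable u μ`, that is, functions measurable with respect to the `μ`-completion of the Borel
sets; `μ`-measurable sets are those with `NullMeasurableSet E μ`. A function norm is a map `N` into
`[0, ∞]`; only its values at `μ`-measurable functions matter. -/

/-- `N` is the norm of a Banach function lattice `X = {u : N u < ∞}` over `(P, μ)`. -/
structure IsBanachFunctionLattice (μ : Measure P) (N : (P → EReal) → ℝ≥0∞) : Prop where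
  eq_zero_iff : ∀ u, AEMeasurable u μ → (N u = 0 ↔ u =ᵐ[μ] 0)
  smul : ∀ (a : ℝ) (u : P → EReal), AEMeasurable u μ →
    N (fun x => (a : EReal) * u x) = ENNReal.ofReal |a| * N u
  /- If both norms are finite, then `u` and `v` are finite a.e., so the value given to `∞ - ∞`
  is immaterial. -/
  add_le : ∀ u v : P → EReal, AEMeasurable u μ → AEMeasurable v μ →
    N (fun x => u x + v x) ≤ N u + N v
  lattice : ∀ u v : P → EReal, AEMeasurable u μ → AEMeasurable v μ →
    (∀ᵐ x ∂μ, (u x).abs ≤ (v x).abs) → N u ≤ N v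
  /- The supremum of the partial sums is the pointwise sum of a series with nonnegative terms. -/
  riesz_fischer : ∀ u : ℕ → P → EReal, (∀ n, AEMeasurable (u n) μ) →
    (∀ n, ∀ᵐ x ∂μ, 0 ≤ u n x) →
    N (fun x => ⨆ n : ℕ, ∑ k ∈ Finset.range n, u k x) ≤ ∑' n, N (u n)

/-- `N` is the norm of a Banach function space over `(P, μ)`. -/
structure IsBanachFunctionSpace (μ : Measure P) (N : (P → EReal) → ℝ≥0∞) : Prop
    extends IsBanachFunctionLattice μ N where
  fatou : ∀ (u : ℕ → P → EReal) (v : P → EReal), (∀ n, AEMeasurable (u n) μ) →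
    AEMeasurable v μ →
    (∀ᵐ x ∂μ, (∀ n, 0 ≤ u n x) ∧ Monotone (fun n => u n x) ∧
      Tendsto (fun n => u n x) atTop (𝓝 (v x))) →
    Monotone (fun n => N (u n)) ∧ Tendsto (fun n => N (u n)) atTop (𝓝 (N v))
  indicator_lt_top : ∀ E : Set P, NullMeasurableSet E μ → μ E < ∞ →
    N (E.indicator (fun _ => (1 : EReal))) < ∞
  lintegral_le : ∀ E : Set P, NullMeasurableSet E μ → μ E < ∞ →
    ∃ C : ℝ≥0, 0 < C ∧ ∀ u : P → EReal, AEMeasurable u μ →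
      ∫⁻ x in E, (u x).abs ∂μ ≤ C * N u

/-- `N` is the norm of a rearrangement-invariant Banach function space over `(P, μ)`:
equimeasurable functions have the same norm. -/
structure IsRearrangementInvariantSpace (μ : Measure P) (N : (P → EReal) → ℝ≥0∞) : Prop
    extends IsBanachFunctionSpace μ N where
  rearrangement : ∀ u v : P → EReal, AEMeasurable u μ → AEMeasurable v μ →
    (∀ t : ℝ≥0, μ {x | (t : ℝ≥0∞) < (u x).abs} = μ {x | (t : ℝ≥0∞) < (v x).abs}) →
    N u = N v

/-- The norm `N` is absolutely continuous. -/
def HasAbsolutelyContinuousNorm (μ : Measure P) (N : (P → EReal) → ℝ≥0∞) : Prop :=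
  ∀ u : P → EReal, AEMeasurable u μ → N u < ∞ →
    ∀ E : ℕ → Set P, (∀ n, NullMeasurableSet (E n) μ) → Antitone E → μ (⋂ n, E n) = 0 →
      Tendsto (fun n => N ((E n).indicator u)) atTop (𝓝 0)

/-- `g` is an upper gradient of `u`. Curves are the nonconstant rectifiable curves, parametrized by
arc length: maps with unit speed on `[0, l]`, where `l > 0` is the length (unit speed makes them
`1`-Lipschitz there). The arithmetic of `EReal` gives `(a - b).abs = ∞` as soon as `a` or `b` is
infinite, including `a = b = ±∞`. -/
def IsUpperGradient (u : P → EReal) (g : P → ℝ≥0∞) : Prop :=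
  Measurable[borel P] g ∧
    ∀ (l : ℝ) (γ : ℝ → P), 0 < l → HasUnitSpeedOn γ (Icc 0 l) →
      (u (γ 0) - u (γ l)).abs ≤ ∫⁻ t in Icc 0 l, g (γ t)

/-- The Newtonian seminorm `‖u‖_{N¹X} = ‖u‖_X + inf_g ‖g‖_X`, the infimum being taken over all
upper gradients `g` of `u`. -/
noncomputable def newtonianNorm (N : (P → EReal) → ℝ≥0∞) (u : P → EReal) : ℝ≥0∞ :=
  N u + ⨅ (g : P → ℝ≥0∞) (_ : IsUpperGradient u g), N (fun x => (g x : EReal))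

/-- The Newtonian space `N¹X`, consisting of functions defined everywhere. -/
def newtonianSpace (μ : Measure P) (N : (P → EReal) → ℝ≥0∞) : Set (P → EReal) :=
  {u | AEMeasurable u μ ∧ newtonianNorm N u < ∞}

/-- `μ` is a doubling measure. -/
def IsDoubling (μ : Measure P) : Prop :=
  ∃ C : ℝ≥0, 1 ≤ C ∧ ∀ (x : P) (r : ℝ), 0 < r →
    μ (Metric.ball x (2 * r)) ≤ C * μ (Metric.ball x r)

/-- `(P, μ)` supports a `p`-Poincaré inequality. Local integrability means integrability on
balls, so that the mean values are well defined. -/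
def SupportsPoincare (μ : Measure P) (p : ℝ) : Prop :=
  ∃ (c : ℝ≥0) (lam : ℝ), 0 < c ∧ 1 ≤ lam ∧
    ∀ (u : P → EReal) (g : P → ℝ≥0∞), AEMeasurable u μ →
      (∀ (x : P) (r : ℝ), 0 < r → ∫⁻ y in Metric.ball x r, (u y).abs ∂μ < ∞) →
      IsUpperGradient u g →
      ∀ (x : P) (r : ℝ), 0 < r →
        ⨍⁻ y in Metric.ball x r,
            (u y - ((⨍ z in Metric.ball x r, (u z).toReal ∂μ : ℝ) : EReal)).abs ∂μ
          ≤ c * Metric.ediam (Metric.ball x r) *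
            (⨍⁻ y in Metric.ball x (lam * r), g y ^ p ∂μ) ^ (1 / p)

end NewtonianLip

namespace NewtonianLip

/-- The norm of a nonnegative function. -/
noncomputable def posNorm {P : Type*} (N : (P → EReal) → ℝ≥0∞) (g : P → ℝ≥0∞) : ℝ≥0∞ :=
  N fun x => (g x : EReal)

section Norm

variable {P : Type*} [MeasurableSpace P] {μ : Measure P}
  {N : (P → EReal) → ℝ≥0∞}

theorem ereal_abs_coe_ennreal (a : ℝ≥0∞) : (a : EReal).abs = a := by
  induction a using ENNReal.recTopCoe with
  | top => rfl
  | coe r =>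
    rw [EReal.coe_nnreal_eq_coe_real, EReal.abs_def, NNReal.abs_eq, ENNReal.ofReal_coe_nnreal]

theorem measurable_ereal_abs : Measurable EReal.abs :=
  EReal.measurable_of_measurable_real measurable_id.abs.ennreal_ofReal

theorem norm_eq_posNorm_abs (hX : IsBanachFunctionLattice μ N) {u : P → EReal}
    (hu : AEMeasurable u μ) : N u = posNorm N fun x => (u x).abs := by
  have h : AEMeasurable (fun x => ((u x).abs : EReal)) μ :=
    (measurable_ereal_abs.comp_aemeasurable hu).coe_ereal_ennreal
  refine le_antisymm (hX.lattice _ _ hu h ?_) (hX.lattice _ _ h hu ?_) <;>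
  · filter_upwards with x
    rw [ereal_abs_coe_ennreal]

theorem posNorm_mono (hX : IsBanachFunctionLattice μ N) {f g : P → ℝ≥0∞}
    (hf : AEMeasurable f μ) (hg : AEMeasurable g μ) (h : f ≤ᵐ[μ] g) :
    posNorm N f ≤ posNorm N g := by
  refine hX.lattice _ _ hf.coe_ereal_ennreal hg.coe_ereal_ennreal ?_
  filter_upwards [h] with x hx
  simpa only [ereal_abs_coe_ennreal] using hx

theorem posNorm_congr (hX : IsBanachFunctionLattice μ N) {f g : P → ℝ≥0∞}
    (hf : AEMeasurable f μ) (h : f =ᵐ[μ] g) : posNorm N f = posNorm N g :=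
  le_antisymm (posNorm_mono hX hf (hf.congr h) h.le) (posNorm_mono hX (hf.congr h) hf h.symm.le)

theorem posNorm_add_le (hX : IsBanachFunctionLattice μ N) {f g : P → ℝ≥0∞}
    (hf : AEMeasurable f μ) (hg : AEMeasurable g μ) :
    posNorm N (fun x => f x + g x) ≤ posNorm N f + posNorm N g := by
  have := hX.add_le _ _ hf.coe_ereal_ennreal hg.coe_ereal_ennreal
  simpa only [posNorm, EReal.coe_ennreal_add] using this

theorem posNorm_const_mul (hX : IsBanachFunctionLattice μ N) {f : P → ℝ≥0∞}
    (hf : AEMeasurable f μ) (c : ℝ≥0) :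
    posNorm N (fun x => c * f x) = c * posNorm N f := by
  have := hX.smul c _ hf.coe_ereal_ennreal
  rw [NNReal.abs_eq, ENNReal.ofReal_coe_nnreal] at this
  simpa only [posNorm, EReal.coe_ennreal_mul, EReal.coe_nnreal_eq_coe_real] using this

theorem posNorm_zero (hX : IsBanachFunctionLattice μ N) : posNorm N (fun _ => 0) = 0 :=
  (hX.eq_zero_iff _ aemeasurable_const.coe_ereal_ennreal).2 (by rfl)

theorem posNorm_sum_le (hX : IsBanachFunctionLattice μ N) {ι : Type*} (s : Finset ι)
    (f : ι → P → ℝ≥0∞) (hf : ∀ i, AEMeasurable (f i) μ) :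
    posNorm N (fun x => ∑ i ∈ s, f i x) ≤ ∑ i ∈ s, posNorm N (f i) := by
  classical
  induction s using Finset.induction_on with
  | empty => simp [posNorm_zero hX]
  | insert a s ha ih =>
    simp only [Finset.sum_insert ha]
    exact (posNorm_add_le hX (hf a) (Finset.aemeasurable_fun_sum s fun i _ => hf i)).trans
      (by gcongr)

theorem aemeasurable_indicator_one {E : Set P} (hE : MeasurableSet E) :
    AEMeasurable (E.indicator (1 : P → ℝ≥0∞)) μ :=
  (measurable_one.indicator hE).aemeasurable

theorem posNorm_rearrangement (hX : IsRearrangementInvariantSpace μ N) {f g : P → ℝ≥0∞}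
    (hf : AEMeasurable f μ) (hg : AEMeasurable g μ)
    (h : ∀ t : ℝ≥0, μ {x | (t : ℝ≥0∞) < f x} = μ {x | (t : ℝ≥0∞) < g x}) :
    posNorm N f = posNorm N g := by
  refine hX.rearrangement _ _ hf.coe_ereal_ennreal hg.coe_ereal_ennreal fun t => ?_
  simpa only [ereal_abs_coe_ennreal] using h t

theorem posNorm_iUnion_indicator_le (hX : IsBanachFunctionSpace μ N) {E : ℕ → Set P}
    (hE : ∀ n, MeasurableSet (E n)) (hmono : Monotone E) {c : ℝ≥0∞}
    (h : ∀ n, posNorm N ((E n).indicator 1) ≤ c) :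
    posNorm N ((⋃ n, E n).indicator 1) ≤ c := by
  have hm : ∀ n, AEMeasurable (fun x => (((E n).indicator 1 x : ℝ≥0∞) : EReal)) μ := fun n =>
    (aemeasurable_one.indicator (hE n)).coe_ereal_ennreal
  have hm' : AEMeasurable (fun x => (((⋃ n, E n).indicator 1 x : ℝ≥0∞) : EReal)) μ :=
    (aemeasurable_one.indicator (MeasurableSet.iUnion hE)).coe_ereal_ennreal
  refine le_of_tendsto' (hX.fatou _ _ hm hm' ?_).2 h
  filter_upwards with x
  refine ⟨fun n => EReal.coe_ennreal_nonneg _, fun m n hmn => ?_, ?_⟩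
  · exact EReal.coe_ennreal_le_coe_ennreal_iff.2
      (indicator_le_indicator_of_subset (hmono hmn) (fun _ => zero_le) x)
  · refine (continuous_coe_ennreal_ereal.tendsto _).comp ?_
    exact (tendsto_indicator_const_apply_iff_eventually atTop (1 : ℝ≥0∞) x).2 (by
      by_cases hx : x ∈ ⋃ n, E n
      · obtain ⟨n, hn⟩ := mem_iUnion.1 hx
        filter_upwards [eventually_ge_atTop n] with m hmn
        exact iff_of_true (hmono hmn hn) hx
      · filter_upwards with m
        exact iff_of_false (fun h => hx (mem_iUnion.2 ⟨m, h⟩)) hx)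

theorem tendsto_posNorm_indicator (hAC : HasAbsolutelyContinuousNorm μ N)
    {f : P → ℝ≥0∞} (hf : AEMeasurable f μ) (hfin : posNorm N f < ∞) {E : ℕ → Set P}
    (hE : ∀ n, NullMeasurableSet (E n) μ) (hanti : Antitone E) (hnull : μ (⋂ n, E n) = 0) :
    Tendsto (fun n => posNorm N ((E n).indicator f)) atTop (𝓝 0) := by
  refine (hAC _ hf.coe_ereal_ennreal hfin E hE hanti hnull).congr fun n => ?_
  congr 1
  ext x
  by_cases hx : x ∈ E n <;> simp [hx]

end Norm

section Topology

variable {P : Type*} [MetricSpace P] [MeasurableSpace P] [BorelSpace P] {μ : Measure P}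

/-- A metric space with a measure for which balls have positive finite measure is separable. -/
theorem secondCountable_of_measure_ball
    (hball : ∀ (x : P) (r : ℝ), 0 < r → 0 < μ (Metric.ball x r) ∧ μ (Metric.ball x r) < ∞) :
    SecondCountableTopology P := by
  rcases isEmpty_or_nonempty P with hP | ⟨⟨x₀⟩⟩
  · infer_instance
  have hσ : SigmaFinite μ := by
    refine ⟨⟨⟨fun n => Metric.ball x₀ (n + 1), fun _ => trivial,
      fun n => (hball x₀ _ (by positivity)).2, ?_⟩⟩⟩
    exact eq_univ_of_forall fun x => mem_iUnion.2 <| by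
      obtain ⟨n, hn⟩ := exists_nat_gt (dist x x₀)
      exact ⟨n, by rw [Metric.mem_ball]; linarith⟩
  refine Metric.secondCountable_of_almost_dense_set fun ε hε => ?_
  obtain ⟨s, -, hs, hmax⟩ := Vitali.exists_disjoint_subfamily_covering_enlargement_closedBall
    (univ : Set P) id (fun _ => ε / 6) (ε / 6) (fun _ _ => le_rfl) 5 (by norm_num)
  refine ⟨s, ?_, fun x => ?_⟩
  · have hc := Measure.countable_meas_pos_of_disjoint_iUnion (μ := μ)
      (As := fun x : s => Metric.closedBall (x : P) (ε / 6))
      (fun _ => Metric.isClosed_closedBall.measurableSet)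
      (fun a b hab => hs a.2 b.2 (Subtype.coe_injective.ne hab))
    have hu : {i : s | 0 < μ (Metric.closedBall (i : P) (ε / 6))} = univ :=
      eq_univ_of_forall fun i => (hball i (ε / 6) (by positivity)).1.trans_le
        (measure_mono Metric.ball_subset_closedBall)
    rw [hu, countable_univ_iff] at hc
    exact countable_coe_iff.1 hc
  · obtain ⟨b, hb, hsub⟩ := hmax x (mem_univ _)
    refine ⟨b, hb, ?_⟩
    have := hsub (Metric.mem_closedBall_self (by positivity))
    rw [Metric.mem_closedBall] at this
    simp only [id] at this
    linarith

/-- A measure without point masses on a separable metric space takes all intermediate values. -/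
theorem exists_subset_measure_eq [SecondCountableTopology P] [NullSingletonClass μ] {E : Set P}
    (hE : MeasurableSet E) (hfin : μ E < ∞) {t : ℝ≥0∞} (ht : t ≤ μ E) :
    ∃ F ⊆ E, MeasurableSet F ∧ μ F = t := by
  rcases eq_or_ne t 0 with rfl | ht0
  · exact ⟨∅, empty_subset _, MeasurableSet.empty, measure_empty⟩
  rcases ht.eq_or_lt with rfl | ht'
  · exact ⟨E, Subset.rfl, hE, rfl⟩
  obtain ⟨h₁, h₁m, h₁i⟩ := MeasurableSpace.measurable_injection_nat_bool_of_countablySeparated P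
  set h : P → ℝ := fun x => embeddingReal (ℕ → Bool) (h₁ x) with hh
  have hm : Measurable h := (measurable_embeddingReal _).comp h₁m
  have hi : Function.Injective h := (measurableEmbedding_embeddingReal _).injective.comp h₁i
  set ν : Measure ℝ := (μ.restrict E).map h with hν
  have : IsFiniteMeasure (μ.restrict E) := ⟨by simpa using hfin⟩
  have hνapp : ∀ s, MeasurableSet s → ν s = μ (h ⁻¹' s ∩ E) := fun s hs => by
    rw [hν, Measure.map_apply hm hs, Measure.restrict_apply (hm hs)]
  have : NullSingletonClass ν := ⟨fun a => by
    rw [hνapp _ (measurableSet_singleton a)]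
    refine measure_mono_null inter_subset_left (Subsingleton.measure_zero ?_ μ)
    exact subsingleton_singleton.preimage hi⟩
  have huniv : ν univ = μ E := by simp [hνapp _ MeasurableSet.univ]
  have hcont : Continuous fun a => ν.real (Iic a) := by
    refine continuous_iff_continuousAt.2 fun a => ?_
    have := IntegrableOn.continuousOn_Iic_primitive_Iic (μ := ν)
      (f := fun _ : ℝ => (1 : ℝ)) (a₀ := a + 1)
      (integrable_const _).integrableOn
    simpa using this.continuousAt (Iic_mem_nhds (by linarith))
  have h0 : Tendsto (fun a => ν.real (Iic a)) atBot (𝓝 0) := by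
    have := tendsto_measure_iInter_atBot (μ := ν) (s := fun a : ℝ => Iic a)
      (fun _ => measurableSet_Iic.nullMeasurableSet) (fun _ _ hab => Iic_subset_Iic.2 hab)
      ⟨0, measure_ne_top _ _⟩
    rw [iInter_Iic_eq_empty_iff.2 (by simp [not_bddBelow_univ]), measure_empty] at this
    exact ENNReal.toReal_zero ▸ (ENNReal.tendsto_toReal ENNReal.zero_ne_top).comp this
  have h1 : Tendsto (fun a => ν.real (Iic a)) atTop (𝓝 (ν.real univ)) :=
    (ENNReal.tendsto_toReal (measure_ne_top _ _)).comp (tendsto_measure_Iic_atTop ν)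
  have htop : t ≠ ∞ := (ht'.trans hfin).ne
  obtain ⟨a, ha⟩ := mem_range_of_exists_le_of_exists_ge hcont
    (c := t.toReal) ((h0.eventually (gt_mem_nhds (ENNReal.toReal_pos ht0 htop))).exists.imp
      fun _ h => h.le)
    ((h1.eventually (lt_mem_nhds (by
      rw [Measure.real, huniv]
      exact (ENNReal.toReal_lt_toReal htop hfin.ne).2 ht'))).exists.imp fun _ h => h.le)
  refine ⟨h ⁻¹' Iic a ∩ E, inter_subset_right, (hm measurableSet_Iic).inter hE, ?_⟩
  rw [← hνapp _ measurableSet_Iic]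
  exact (ENNReal.toReal_eq_toReal_iff' (measure_ne_top _ _) htop).1 ha

end Topology

section StepFunction

variable {P : Type*}

theorem sum_indicator_of_mem {ι : Type*} [Fintype ι] {Q : ι → Set P}
    (hd : Pairwise (Function.onFun Disjoint Q)) (b : ι → ℝ≥0∞) {x : P} {i : ι} (hx : x ∈ Q i) :
    ∑ j, (Q j).indicator (fun _ => b j) x = b i := by
  rw [Finset.sum_eq_single i, indicator_of_mem hx]
  · intro j _ hji
    exact indicator_of_notMem (fun hj => (hd hji).le_bot ⟨hj, hx⟩) _
  · simp

theorem sum_indicator_of_notMem {ι : Type*} [Fintype ι] {Q : ι → Set P}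
    (b : ι → ℝ≥0∞) {x : P} (hx : x ∉ ⋃ i, Q i) :
    ∑ j, (Q j).indicator (fun _ => b j) x = 0 :=
  Finset.sum_eq_zero fun j _ => indicator_of_notMem (fun hj => hx (mem_iUnion.2 ⟨j, hj⟩)) _

variable [MeasurableSpace P] {μ : Measure P} {N : (P → EReal) → ℝ≥0∞}

theorem measurable_sum_indicator {ι : Type*} [Fintype ι] {Q : ι → Set P}
    (hQ : ∀ i, MeasurableSet (Q i)) (b : ι → ℝ≥0∞) :
    Measurable fun x => ∑ j, (Q j).indicator (fun _ => b j) x :=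
  Finset.measurable_fun_sum _ fun j _ => measurable_const.indicator (hQ j)

theorem measure_lt_sum_indicator {ι : Type*} [Fintype ι] {Q : ι → Set P}
    (hQ : ∀ i, MeasurableSet (Q i)) (hd : Pairwise (Function.onFun Disjoint Q)) (b : ι → ℝ≥0∞)
    (s : ℝ≥0∞) :
    μ {x | s < ∑ j, (Q j).indicator (fun _ => b j) x} = ∑ i, if s < b i then μ (Q i) else 0 := by
  have h : {x | s < ∑ j, (Q j).indicator (fun _ => b j) x} =
      ⋃ i ∈ Finset.univ.filter fun i => s < b i, Q i := by
    ext x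
    simp only [mem_ofPred_eq, mem_iUnion, Finset.mem_filter, Finset.mem_univ, true_and, exists_prop]
    constructor
    · intro hx
      by_cases hx' : x ∈ ⋃ i, Q i
      · obtain ⟨i, hi⟩ := mem_iUnion.1 hx'
        rw [sum_indicator_of_mem hd b hi] at hx
        exact ⟨i, hx, hi⟩
      · rw [sum_indicator_of_notMem b hx'] at hx
        exact absurd hx not_lt_zero
    · rintro ⟨i, hi, hxi⟩
      rwa [sum_indicator_of_mem hd b hxi]
  rw [h, measure_biUnion_finset (fun i _ j _ hij => hd hij) (fun i _ => hQ i),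
    Finset.sum_filter]

/-- Averaging a step function over pieces of equal measure does not increase its norm. -/
theorem sum_mul_posNorm_indicator_le (hX : IsRearrangementInvariantSpace μ N)
    {ι : Type*} [Fintype ι] [Nonempty ι] {Q : ι → Set P} (hQ : ∀ i, MeasurableSet (Q i))
    (hd : Pairwise (Function.onFun Disjoint Q)) {t : ℝ≥0∞} (ht : ∀ i, μ (Q i) = t)
    (a : ι → ℝ≥0) :
    (∑ i, a i : ℝ≥0) * posNorm N ((⋃ i, Q i).indicator 1) ≤
      Fintype.card ι * posNorm N (fun x => ∑ i, (Q i).indicator (fun _ => (a i : ℝ≥0∞)) x) := by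
  classical
  have hne : NeZero (Fintype.card ι) := ⟨Fintype.card_ne_zero⟩
  let e : ι ≃ ZMod (Fintype.card ι) := Fintype.equivOfCardEq (ZMod.card _).symm
  let σ : ZMod (Fintype.card ι) → ι ≃ ι := fun c => (e.trans (Equiv.addRight c)).trans e.symm
  let F : ZMod (Fintype.card ι) → P → ℝ≥0∞ := fun c x =>
    ∑ i, (Q i).indicator (fun _ => (a (σ c i) : ℝ≥0∞)) x
  have hF : ∀ c, Measurable (F c) := fun c => measurable_sum_indicator hQ _
  have hUm : MeasurableSet (⋃ i, Q i) := MeasurableSet.iUnion hQ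
  have hsum : ∀ i, ∑ c, a (σ c i) = ∑ i, a i := fun i =>
    Fintype.sum_equiv ((Equiv.addLeft (e i)).trans e.symm) _ _ fun c => rfl
  have hconst : ∀ x, ∑ c, F c x = (∑ i, a i : ℝ≥0) * (⋃ i, Q i).indicator 1 x := by
    intro x
    by_cases hx : x ∈ ⋃ i, Q i
    · obtain ⟨i, hi⟩ := mem_iUnion.1 hx
      rw [indicator_of_mem hx, Pi.one_apply, mul_one, ← hsum i, ENNReal.ofNNReal_finsetSum]
      exact Finset.sum_congr rfl fun c _ => sum_indicator_of_mem hd _ hi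
    · rw [indicator_of_notMem hx, mul_zero]
      exact Finset.sum_eq_zero fun c _ => sum_indicator_of_notMem _ hx
  have hrearr : ∀ c, posNorm N (F c) =
      posNorm N (fun x => ∑ i, (Q i).indicator (fun _ => (a i : ℝ≥0∞)) x) := by
    intro c
    refine posNorm_rearrangement hX (hF c).aemeasurable
      (measurable_sum_indicator hQ _).aemeasurable fun s => ?_
    rw [measure_lt_sum_indicator hQ hd, measure_lt_sum_indicator hQ hd]
    simp only [ht]
    exact Fintype.sum_equiv (σ c) _ _ fun i => rfl
  calc (∑ i, a i : ℝ≥0) * posNorm N ((⋃ i, Q i).indicator 1)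
      = posNorm N (fun x => ∑ c, F c x) := by
        rw [← posNorm_const_mul hX.toIsBanachFunctionLattice
          (aemeasurable_indicator_one hUm)]
        simp only [hconst]
    _ ≤ ∑ c, posNorm N (F c) :=
        posNorm_sum_le hX.toIsBanachFunctionLattice _ _ fun c => (hF c).aemeasurable
    _ = _ := by simp [hrearr, ZMod.card]

end StepFunction

section Averaging

variable {P : Type*} [MetricSpace P] [MeasurableSpace P] [BorelSpace P] {μ : Measure P}
  {N : (P → EReal) → ℝ≥0∞} [SecondCountableTopology P] [NullSingletonClass μ]

theorem posNorm_indicator_le_of_measure_le (hX : IsRearrangementInvariantSpace μ N)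
    {E A : Set P} (hE : MeasurableSet E) (hA : MeasurableSet A) (hAfin : μ A < ∞)
    (h : μ E ≤ μ A) : posNorm N (E.indicator 1) ≤ posNorm N (A.indicator 1) := by
  obtain ⟨F, hFA, hF, hFE⟩ := exists_subset_measure_eq hA hAfin h
  have hset : ∀ (S : Set P) (t : ℝ≥0), {x | (t : ℝ≥0∞) < S.indicator 1 x} =
      if t < 1 then S else ∅ := by
    intro S t
    ext x
    by_cases hx : x ∈ S <;> by_cases ht : t < 1 <;> simp [hx, ht]
  refine (posNorm_rearrangement hX (aemeasurable_indicator_one hE)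
    (aemeasurable_indicator_one hF) fun t => ?_).trans_le
    (posNorm_mono hX.toIsBanachFunctionLattice (aemeasurable_indicator_one hF)
      (aemeasurable_indicator_one hA) ?_)
  · rw [hset, hset]
    split_ifs
    · exact hFE.symm
    · rfl
  · exact Eventually.of_forall (indicator_le_indicator_of_subset hFA fun _ => zero_le)

theorem posNorm_indicator_le_of_measure_le_mul (hX : IsRearrangementInvariantSpace μ N)
    {A : Set P} (hA : MeasurableSet A) (hAfin : μ A < ∞) (m : ℕ) {E : Set P}
    (hE : MeasurableSet E) (h : μ E ≤ m * μ A) :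
    posNorm N (E.indicator 1) ≤ m * posNorm N (A.indicator 1) := by
  induction m generalizing E with
  | zero =>
    have h0 : μ E = 0 := by simpa using h
    have := posNorm_indicator_le_of_measure_le hX hE MeasurableSet.empty (by simp)
      (h0.trans_le zero_le)
    rw [indicator_empty] at this
    simpa using this.trans_eq (posNorm_zero hX.toIsBanachFunctionLattice)
  | succ m ih =>
    rcases le_total (μ E) (μ A) with hEA | hAE
    · refine (posNorm_indicator_le_of_measure_le hX hE hA hAfin hEA).trans ?_
      exact le_mul_of_one_le_left' (by simp)
    · have hEfin : μ E < ∞ := h.trans_lt (ENNReal.mul_lt_top (ENNReal.natCast_lt_top _) hAfin)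
      obtain ⟨F, hFE, hF, hFA⟩ := exists_subset_measure_eq hE hEfin hAE
      have hdiff : μ (E \ F) ≤ m * μ A := by
        rw [measure_sdiff hFE hF.nullMeasurableSet (hFA ▸ hAfin.ne), hFA]
        refine tsub_le_iff_right.2 (h.trans_eq ?_)
        push_cast
        ring
      calc posNorm N (E.indicator 1)
          = posNorm N (fun x => (E \ F).indicator 1 x + F.indicator 1 x) := by
            congr 1
            ext x
            by_cases hxF : x ∈ F
            · simp [hxF, hFE hxF]
            · by_cases hxE : x ∈ E <;> simp [hxF, hxE]
        _ ≤ posNorm N ((E \ F).indicator 1) + posNorm N (F.indicator 1) :=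
            posNorm_add_le hX.toIsBanachFunctionLattice (aemeasurable_indicator_one (hE.diff hF))
              (aemeasurable_indicator_one hF)
        _ ≤ m * posNorm N (A.indicator 1) + posNorm N (A.indicator 1) :=
            add_le_add (ih (hE.diff hF) hdiff)
              (posNorm_indicator_le_of_measure_le hX hF hA hAfin hFA.le)
        _ = _ := by push_cast; ring

theorem exists_disjoint_subsets_measure_eq {t : ℝ≥0∞} (k : ℕ) {S : Set P}
    (hS : MeasurableSet S) (hfin : μ S < ∞) (h : k * t ≤ μ S) :
    ∃ Q : Fin k → Set P, (∀ i, MeasurableSet (Q i)) ∧ Pairwise (Function.onFun Disjoint Q) ∧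
      (∀ i, Q i ⊆ S) ∧ ∀ i, μ (Q i) = t := by
  induction k generalizing S with
  | zero => exact ⟨fun _ => ∅, fun i => i.elim0, fun i => i.elim0, fun i => i.elim0,
      fun i => i.elim0⟩
  | succ k ih =>
    have hle : t ≤ μ S := (le_mul_of_one_le_left' (by simp)).trans h
    obtain ⟨F, hFS, hF, hFt⟩ := exists_subset_measure_eq hS hfin hle
    obtain ⟨Q, hQ, hd, hQS, hQt⟩ := ih (hS.diff hF)
      ((measure_mono sdiff_subset).trans_lt hfin) (by
        rw [measure_sdiff hFS hF.nullMeasurableSet (hFt ▸ (hle.trans_lt hfin).ne), hFt]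
        refine ENNReal.le_sub_of_add_le_right (hle.trans_lt hfin).ne (le_trans (le_of_eq ?_) h)
        push_cast
        ring)
    have hdF : ∀ i, Disjoint F (Q i) := fun i => disjoint_sdiff_right.mono_right (hQS i)
    refine ⟨Fin.cons F Q, Fin.cases hF hQ, ?_, Fin.cases hFS fun i => (hQS i).trans sdiff_subset,
      Fin.cases hFt hQt⟩
    intro i j
    refine Fin.cases ?_ (fun i => ?_) i <;> refine Fin.cases ?_ (fun j => ?_) j
    · exact fun h => absurd rfl h
    · exact fun _ => hdF j
    · exact fun _ => (hdF i).symm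
    · exact fun h => hd fun hij => h (congrArg Fin.succ hij)

theorem exists_packing {t : ℝ≥0} (ht : 0 < t) {S : Set P} (hS : MeasurableSet S)
    (hfin : μ S < ∞) :
    ∃ (k : ℕ) (Q : Fin k → Set P), (∀ i, MeasurableSet (Q i)) ∧
      Pairwise (Function.onFun Disjoint Q) ∧ (∀ i, Q i ⊆ S) ∧ (∀ i, μ (Q i) = t) ∧
      μ S ≤ k * t + t := by
  lift μ S to ℝ≥0 using hfin.ne with m hm
  have hk : (⌊m / t⌋₊ : ℝ≥0) * t ≤ m := by
    have := Nat.floor_le (zero_le (a := m / t))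
    exact (le_div_iff₀ ht).1 this
  have hk' : m ≤ ⌊m / t⌋₊ * t + t := by
    have := (Nat.lt_floor_add_one (m / t)).le
    rw [div_le_iff₀ ht, add_mul, one_mul] at this
    exact this
  obtain ⟨Q, hQ⟩ := exists_disjoint_subsets_measure_eq (μ := μ) (t := t) ⌊m / t⌋₊ hS
    (by rw [← hm]; exact ENNReal.coe_lt_top) (by rw [← hm]; exact_mod_cast hk)
  exact ⟨_, Q, hQ.1, hQ.2.1, hQ.2.2.1, hQ.2.2.2, by exact_mod_cast hk'⟩

theorem mul_posNorm_indicator_le_of_lt_lintegral (hX : IsRearrangementInvariantSpace μ N)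
    {A : Set P} (hA : MeasurableSet A) (hAfin : μ A < ∞) {g : P → ℝ≥0∞} (hg : Measurable g)
    {σ : ℝ≥0} (h : σ * μ A < ∫⁻ x in A, g x ∂μ) :
    σ * posNorm N (A.indicator 1) ≤ 4 * posNorm N g := by
  have hL := hX.toIsBanachFunctionLattice
  rcases eq_or_ne σ 0 with rfl | hσ
  · simp
  obtain ⟨m, hm⟩ : ∃ m : ℝ≥0, (m : ℝ≥0∞) = μ A := ⟨_, ENNReal.coe_toNNReal hAfin.ne⟩
  rcases eq_or_ne m 0 with rfl | hm0
  · have h0 : posNorm N (A.indicator 1) ≤ (0 : ℕ) * posNorm N (A.indicator 1) :=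
      posNorm_indicator_le_of_measure_le_mul hX hA hAfin 0 hA (by simp [← hm])
    rw [Nat.cast_zero, zero_mul, nonpos_iff_eq_zero] at h0
    simp [h0]
  rw [lintegral_eq_nnreal] at h
  simp only [lt_iSup_iff] at h
  obtain ⟨φ, hφ, hlt⟩ := h
  rw [SimpleFunc.map_lintegral] at hlt
  set V := φ.range
  obtain ⟨t, ht0, ht1, ht2⟩ : ∃ t : ℝ≥0, 0 < t ∧ t * ∑ v ∈ V, v ≤ σ * m / 2 ∧
      t * V.card ≤ m / 2 := by
    have hσ' : 0 < σ := pos_iff_ne_zero.2 hσ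
    have hm' : 0 < m := pos_iff_ne_zero.2 hm0
    refine ⟨min (σ * m / 2 / (∑ v ∈ V, v + 1)) (m / 2 / (V.card + 1)), by positivity, ?_, ?_⟩
    · calc _ ≤ σ * m / 2 / (∑ v ∈ V, v + 1) * (∑ v ∈ V, v + 1) := by
            gcongr
            · exact min_le_left _ _
            · exact le_self_add
        _ = _ := div_mul_cancel₀ _ (by positivity)
    · calc _ ≤ m / 2 / (V.card + 1) * (V.card + 1) := by
            gcongr
            · exact min_le_right _ _
            · exact le_self_add
        _ = _ := div_mul_cancel₀ _ (by positivity)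
  have hSm : ∀ v, MeasurableSet (φ ⁻¹' {v} ∩ A) := fun v =>
    (φ.measurableSet_fiber v).inter hA
  have hSfin : ∀ v, μ (φ ⁻¹' {v} ∩ A) < ∞ := fun v =>
    (measure_mono inter_subset_right).trans_lt hAfin
  choose k Q hQm hQd hQS hQt hQk using fun v => exists_packing ht0 (hSm v) (hSfin v)
  let ι := Σ v : V, Fin (k v)
  let R : ι → Set P := fun i => Q i.1 i.2
  have hRA : ∀ i, R i ⊆ A := fun i => (hQS _ _).trans inter_subset_right
  have hRm : ∀ i, MeasurableSet (R i) := fun i => hQm _ _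
  have hRt : ∀ i, μ (R i) = t := fun i => hQt _ _
  have hRφ : ∀ i, ∀ x ∈ R i, φ x = i.1 := fun i x hx => (hQS _ _ hx).1
  have hRd : Pairwise (Function.onFun Disjoint R) := by
    rintro ⟨v, i⟩ ⟨w, j⟩ hij
    rcases eq_or_ne v w with rfl | hvw
    · exact hQd v fun h => hij (congrArg (Sigma.mk v) h)
    · refine Set.disjoint_left.2 fun x hx hy => hvw (Subtype.ext ?_)
      exact (hRφ ⟨v, i⟩ x hx).symm.trans (hRφ ⟨w, j⟩ x hy)
  have hUm : MeasurableSet (⋃ i, R i) := MeasurableSet.iUnion hRm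
  have hUμ : μ (⋃ i, R i) = Fintype.card ι * t := by
    rw [measure_iUnion hRd hRm, tsum_fintype]
    simp [hRt]
  have hcard : (Fintype.card ι : ℝ≥0) = ∑ v ∈ V, (k v : ℝ≥0) := by
    rw [Fintype.card_sigma, ← Finset.sum_coe_sort V]
    simp
  have hasum : (∑ i : ι, (i.1 : ℝ≥0)) = ∑ v ∈ V, k v * v := by
    rw [Fintype.sum_sigma, ← Finset.sum_coe_sort V]
    simp
  have hlow : m ≤ 2 * (Fintype.card ι * t) := by
    have h1 : μ A ≤ ∑ v ∈ V, μ (φ ⁻¹' {v} ∩ A) := by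
      refine (measure_mono fun x hx => ?_).trans (measure_biUnion_finset_le V _)
      exact mem_biUnion (φ.mem_range_self x) ⟨rfl, hx⟩
    have h2 : μ A ≤ ((∑ v ∈ V, (k v * t + t) : ℝ≥0) : ℝ≥0∞) := by
      refine h1.trans ((Finset.sum_le_sum fun v _ => hQk v).trans_eq ?_)
      push_cast
      rfl
    rw [← hm, ENNReal.coe_le_coe, Finset.sum_add_distrib, ← Finset.sum_mul, ← hcard,
      Finset.sum_const, nsmul_eq_mul, mul_comm (V.card : ℝ≥0)] at h2
    have h3 := h2.trans (add_le_add_right ht2 _)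
    rw [← NNReal.coe_le_coe] at h3 ⊢
    push_cast at h3 ⊢
    linarith
  have hvint : σ * m ≤ 2 * ((∑ i : ι, (i.1 : ℝ≥0)) * t) := by
    have h2 : ∑ v ∈ V, (v : ℝ≥0∞) * μ.restrict A (φ ⁻¹' {v}) ≤
        ((∑ v ∈ V, v * (k v * t + t) : ℝ≥0) : ℝ≥0∞) := by
      push_cast
      refine Finset.sum_le_sum fun v _ => ?_
      rw [Measure.restrict_apply (φ.measurableSet_fiber v)]
      gcongr
      exact hQk v
    have h3 := hlt.le.trans h2
    rw [← hm, ← ENNReal.coe_mul, ENNReal.coe_le_coe] at h3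
    have h4 : ∑ v ∈ V, v * (k v * t + t) = (∑ i : ι, (i.1 : ℝ≥0)) * t + t * ∑ v ∈ V, v := by
      rw [hasum, Finset.sum_mul, Finset.mul_sum, ← Finset.sum_add_distrib]
      exact Finset.sum_congr rfl fun v _ => by ring
    have h5 := (h3.trans_eq h4).trans (add_le_add_right ht1 _)
    rw [← NNReal.coe_le_coe] at h5 ⊢
    push_cast at h5 ⊢
    linarith
  have hne : Nonempty ι := by
    rw [← Fintype.card_pos_iff, Nat.pos_iff_ne_zero]
    intro h0
    rw [h0] at hlow
    simp [hm0] at hlow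
  have havg := sum_mul_posNorm_indicator_le hX hRm hRd hRt fun i : ι => (i.1 : ℝ≥0)
  have hGg : posNorm N (fun x => ∑ i : ι, (R i).indicator (fun _ => ((i.1 : ℝ≥0) : ℝ≥0∞)) x) ≤
      posNorm N g := by
    refine posNorm_mono hL (measurable_sum_indicator hRm _).aemeasurable hg.aemeasurable ?_
    filter_upwards with x
    by_cases hx : x ∈ ⋃ i, R i
    · obtain ⟨i, hi⟩ := mem_iUnion.1 hx
      rw [sum_indicator_of_mem hRd _ hi, ← hRφ i x hi]
      exact hφ x
    · rw [sum_indicator_of_notMem _ hx]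
      exact zero_le
  have hAU : posNorm N (A.indicator 1) ≤ 2 * posNorm N ((⋃ i, R i).indicator 1) := by
    refine posNorm_indicator_le_of_measure_le_mul hX hUm
      ((measure_mono (iUnion_subset hRA)).trans_lt hAfin) 2 hA ?_
    rw [hUμ, ← hm]
    exact_mod_cast hlow
  have hUA : (Fintype.card ι : ℝ≥0∞) * t ≤ m := by
    rw [← hUμ, hm]
    exact measure_mono (iUnion_subset hRA)
  have hm0' : (m : ℝ≥0∞) ≠ 0 := by exact_mod_cast hm0
  refine (ENNReal.mul_le_mul_iff_right hm0' ENNReal.coe_ne_top).1 ?_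
  calc (m : ℝ≥0∞) * (σ * posNorm N (A.indicator 1))
      = ((σ * m : ℝ≥0) : ℝ≥0∞) * posNorm N (A.indicator 1) := by push_cast; ring
    _ ≤ ((2 * ((∑ i : ι, (i.1 : ℝ≥0)) * t) : ℝ≥0) : ℝ≥0∞) *
        (2 * posNorm N ((⋃ i, R i).indicator 1)) := by
        gcongr
    _ = 4 * t * ((∑ i : ι, (i.1 : ℝ≥0) : ℝ≥0) * posNorm N ((⋃ i, R i).indicator 1)) := by
        rw [ENNReal.coe_mul, ENNReal.coe_mul, ENNReal.coe_ofNat]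
        ring
    _ ≤ 4 * t * (Fintype.card ι * posNorm N g) :=
        mul_le_mul_right (havg.trans (mul_le_mul_right hGg _)) _
    _ = (Fintype.card ι * t) * (4 * posNorm N g) := by ring
    _ ≤ m * (4 * posNorm N g) := by gcongr

theorem mul_posNorm_indicator_le_of_le_lintegral (hX : IsRearrangementInvariantSpace μ N)
    {A : Set P} (hA : MeasurableSet A) (hAfin : μ A < ∞) {g : P → ℝ≥0∞} (hg : Measurable g)
    {σ : ℝ≥0} (h : σ * μ A ≤ ∫⁻ x in A, g x ∂μ) :
    σ * posNorm N (A.indicator 1) ≤ 8 * posNorm N g := by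
  rcases eq_or_ne (σ * μ A) 0 with h0 | h0
  · rcases mul_eq_zero.1 h0 with h0 | h0
    · simp [h0]
    · have h0 : posNorm N (A.indicator 1) ≤ (0 : ℕ) * posNorm N (A.indicator 1) :=
        posNorm_indicator_le_of_measure_le_mul hX hA hAfin 0 hA (by simp [h0])
      rw [Nat.cast_zero, zero_mul, nonpos_iff_eq_zero] at h0
      simp [h0]
  have hhalf : ((σ / 2 : ℝ≥0) : ℝ≥0∞) * μ A < ∫⁻ x in A, g x ∂μ := by
    refine lt_of_lt_of_le ?_ h
    have := ENNReal.half_lt_self h0 (ENNReal.mul_lt_top ENNReal.coe_lt_top hAfin).ne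
    convert this using 1
    rw [ENNReal.coe_div two_ne_zero, ENNReal.coe_ofNat, ENNReal.div_eq_inv_mul,
      ENNReal.div_eq_inv_mul, mul_assoc]
  have := mul_posNorm_indicator_le_of_lt_lintegral hX hA hAfin hg hhalf
  calc σ * posNorm N (A.indicator 1)
      = 2 * (((σ / 2 : ℝ≥0) : ℝ≥0∞) * posNorm N (A.indicator 1)) := by
        rw [← mul_assoc, ← ENNReal.coe_ofNat, ← ENNReal.coe_mul, mul_div_cancel₀ _ two_ne_zero]
    _ ≤ 2 * (4 * posNorm N g) := by gcongr
    _ = 8 * posNorm N g := by rw [← mul_assoc]; norm_num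

/-- A weak type estimate for the maximal function restricted to radii at most `1`. -/
theorem exists_isOpen_weak_type (hX : IsRearrangementInvariantSpace μ N)
    (hball : ∀ (x : P) (r : ℝ), 0 < r → 0 < μ (Metric.ball x r) ∧ μ (Metric.ball x r) < ∞)
    {C : ℝ≥0} (hC : ∀ (x : P) (r : ℝ), 0 < r →
      μ (Metric.ball x (2 * r)) ≤ C * μ (Metric.ball x r))
    {g : P → ℝ≥0∞} (hg : Measurable g) (σ : ℝ≥0) :
    ∃ E : Set P, IsOpen E ∧
      (∀ x ∉ E, ∀ s : ℝ, 0 < s → s ≤ 1 →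
        ∫⁻ y in Metric.ball x s, g y ∂μ ≤ σ * μ (Metric.ball x s)) ∧
      σ * posNorm N (E.indicator 1) ≤ ⌈C ^ 3⌉₊ * (8 * posNorm N g) := by
  classical
  let T : Set P := {x | ∃ s : ℝ, 0 < s ∧ s ≤ 1 ∧
    σ * μ (Metric.ball x s) ≤ ∫⁻ y in Metric.ball x s, g y ∂μ}
  have hr : ∀ x, ∃ s : ℝ, x ∈ T → 0 < s ∧ s ≤ 1 ∧
      σ * μ (Metric.ball x s) ≤ ∫⁻ y in Metric.ball x s, g y ∂μ := fun x => by
    by_cases hx : x ∈ T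
    · obtain ⟨s, hs⟩ := hx
      exact ⟨s, fun _ => hs⟩
    · exact ⟨0, fun h => absurd h hx⟩
  choose r hr using hr
  obtain ⟨U, hUT, hUd, hUcov⟩ := Vitali.exists_disjoint_subfamily_covering_enlargement_closedBall
    T id r 1 (fun a ha => (hr a ha).2.1) 5 (by norm_num)
  have hd : U.PairwiseDisjoint fun a => Metric.ball a (r a) := fun a ha b hb hab =>
    (hUd ha hb hab).mono Metric.ball_subset_closedBall Metric.ball_subset_closedBall
  have hUc : U.Countable := hd.countable_of_isOpen (fun _ _ => Metric.isOpen_ball)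
    fun a ha => ⟨a, Metric.mem_ball_self (hr a (hUT ha)).1⟩
  have h8 : ∀ a ∈ U, μ (Metric.ball a (8 * r a)) ≤ (C ^ 3 : ℝ≥0) * μ (Metric.ball a (r a)) := by
    intro a ha
    have hpos := (hr a (hUT ha)).1
    calc μ (Metric.ball a (8 * r a)) = μ (Metric.ball a (2 * (2 * (2 * r a)))) := by
          congr 2; ring
      _ ≤ C * (C * (C * μ (Metric.ball a (r a)))) := by
          refine (hC _ _ (by positivity)).trans ?_
          gcongr
          refine (hC _ _ (by positivity)).trans ?_
          gcongr
          exact hC _ _ hpos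
      _ = _ := by push_cast; ring
  have hcover : ∀ x ∈ T, x ∈ ⋃ a ∈ U, Metric.ball a (8 * r a) := by
    intro x hx
    obtain ⟨b, hb, hsub⟩ := hUcov x hx
    have hpos := (hr b (hUT hb)).1
    refine mem_biUnion hb (Metric.closedBall_subset_ball (by simpa using by linarith)
      (hsub (Metric.mem_closedBall_self (hr x hx).1.le)))
  refine ⟨⋃ a ∈ U, Metric.ball a (8 * r a), isOpen_biUnion fun _ _ => Metric.isOpen_ball,
    fun x hx s hs0 hs1 => ?_, ?_⟩
  · by_contra hlt
    exact hx (hcover x ⟨s, hs0, hs1, (not_le.1 hlt).le⟩)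
  have key : ∀ F : Finset P, (F : Set P) ⊆ U →
      σ * posNorm N ((⋃ a ∈ F, Metric.ball a (8 * r a)).indicator 1) ≤
        ⌈C ^ 3⌉₊ * (8 * posNorm N g) := by
    intro F hF
    have hAm : MeasurableSet (⋃ a ∈ F, Metric.ball a (r a)) :=
      F.measurableSet_biUnion fun _ _ => measurableSet_ball
    have hFd : (F : Set P).PairwiseDisjoint fun a => Metric.ball a (r a) := hd.subset hF
    have hAμ : μ (⋃ a ∈ F, Metric.ball a (r a)) = ∑ a ∈ F, μ (Metric.ball a (r a)) :=
      measure_biUnion_finset hFd fun _ _ => measurableSet_ball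
    have hAfin : μ (⋃ a ∈ F, Metric.ball a (r a)) < ∞ := by
      rw [hAμ, ENNReal.sum_lt_top]
      exact fun a ha => (hball a _ (hr a (hUT (hF ha))).1).2
    have hEμ : μ (⋃ a ∈ F, Metric.ball a (8 * r a)) ≤
        ⌈C ^ 3⌉₊ * μ (⋃ a ∈ F, Metric.ball a (r a)) := by
      refine (measure_biUnion_finset_le F _).trans ?_
      rw [hAμ, Finset.mul_sum]
      refine Finset.sum_le_sum fun a ha => (h8 a (hF ha)).trans ?_
      gcongr
      have hceil : C ^ 3 ≤ (⌈C ^ 3⌉₊ : ℝ≥0) := Nat.le_ceil _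
      exact (ENNReal.coe_le_coe.2 hceil).trans_eq (ENNReal.coe_natCast _)
    have hvint : σ * μ (⋃ a ∈ F, Metric.ball a (r a)) ≤
        ∫⁻ x in ⋃ a ∈ F, Metric.ball a (r a), g x ∂μ := by
      rw [lintegral_biUnion_finset hFd fun _ _ => measurableSet_ball, hAμ, Finset.mul_sum]
      exact Finset.sum_le_sum fun a ha => (hr a (hUT (hF ha))).2.2
    calc σ * posNorm N ((⋃ a ∈ F, Metric.ball a (8 * r a)).indicator 1)
        ≤ σ * (⌈C ^ 3⌉₊ * posNorm N ((⋃ a ∈ F, Metric.ball a (r a)).indicator 1)) := by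
          gcongr
          exact posNorm_indicator_le_of_measure_le_mul hX hAm hAfin _
            (F.measurableSet_biUnion fun _ _ => measurableSet_ball) hEμ
      _ = ⌈C ^ 3⌉₊ * (σ * posNorm N ((⋃ a ∈ F, Metric.ball a (r a)).indicator 1)) := by ring
      _ ≤ _ := mul_le_mul_right
          (mul_posNorm_indicator_le_of_le_lintegral hX hAm hAfin hg hvint) _
  rcases U.eq_empty_or_nonempty with rfl | hUne
  · simpa using key ∅ (by simp)
  rcases eq_or_ne σ 0 with rfl | hσ
  · simp
  obtain ⟨f, hf⟩ := hUc.exists_eq_range hUne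
  have hσ' : (σ : ℝ≥0∞) ≠ 0 := by exact_mod_cast hσ
  have hset : (⋃ a ∈ U, Metric.ball a (8 * r a)) =
      ⋃ n, ⋃ a ∈ (Finset.range n).image f, Metric.ball a (8 * r a) := by
    ext x
    simp only [hf, mem_iUnion, mem_range, Finset.mem_image, Finset.mem_range, exists_prop]
    constructor
    · rintro ⟨_, ⟨n, rfl⟩, hx⟩
      exact ⟨n + 1, _, ⟨n, n.lt_succ_self, rfl⟩, hx⟩
    · rintro ⟨n, _, ⟨i, -, rfl⟩, hx⟩
      exact ⟨_, ⟨i, rfl⟩, hx⟩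
  rw [hset, mul_comm, ← ENNReal.le_div_iff_mul_le (Or.inl hσ') (Or.inl ENNReal.coe_ne_top)]
  refine posNorm_iUnion_indicator_le hX.toIsBanachFunctionSpace
    (fun n => Finset.measurableSet_biUnion _ fun _ _ => measurableSet_ball) ?_ fun n => ?_
  · intro m n hmn
    refine biUnion_subset_biUnion_left ?_
    intro a ha
    exact Finset.image_subset_image (Finset.range_mono hmn) ha
  · rw [ENNReal.le_div_iff_mul_le (Or.inl hσ') (Or.inl ENNReal.coe_ne_top), mul_comm]
    refine key _ ?_
    rw [hf]
    simp only [Finset.coe_image]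
    exact image_subset_range _ _

end Averaging

section Curves

variable {P : Type*} [MetricSpace P]

theorem hasUnitSpeedOn_shift {γ : ℝ → P} {l s t : ℝ} (hγ : HasUnitSpeedOn γ (Icc 0 l))
    (hs : 0 ≤ s) (ht : t ≤ l) : HasUnitSpeedOn (fun τ => γ (s + τ)) (Icc 0 (t - s)) := by
  refine hasConstantSpeedOnWith_iff_ordered.2 fun x hx y hy hxy => ?_
  have hsub : Icc 0 (t - s) ∩ Icc x y = Icc x y :=
    inter_eq_right.2 (Icc_subset_Icc hx.1 hy.2)
  have hsub' : Icc 0 l ∩ Icc (s + x) (s + y) = Icc (s + x) (s + y) :=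
    inter_eq_right.2 (Icc_subset_Icc (by linarith [hx.1]) (by linarith [hy.2]))
  have h := hasConstantSpeedOnWith_iff_ordered.1 hγ (x := s + x)
    ⟨by linarith [hx.1], by linarith [hx.2]⟩ (y := s + y)
    ⟨by linarith [hy.1], by linarith [hy.2]⟩ (by linarith)
  rw [hsub'] at h
  rw [hsub]
  have hc := eVariationOn.comp_eq_of_monotoneOn γ (fun τ => s + τ) (t := Icc x y)
    (fun a _ b _ hab => by simpa using hab)
  rw [image_const_add_Icc, h] at hc
  rw [show y - x = s + y - (s + x) by ring]
  exact hc

theorem edist_le_of_hasUnitSpeedOn {γ : ℝ → P} {l : ℝ} (hl : 0 ≤ l)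
    (hγ : HasUnitSpeedOn γ (Icc 0 l)) : edist (γ 0) (γ l) ≤ ENNReal.ofReal l := by
  have h := hasConstantSpeedOnWith_iff_ordered.1 hγ (left_mem_Icc.2 hl) (right_mem_Icc.2 hl) hl
  rw [inter_self] at h
  refine (eVariationOn.edist_le γ (left_mem_Icc.2 hl) (right_mem_Icc.2 hl)).trans_eq ?_
  rw [h]
  simp

theorem IsUpperGradient.abs_sub_le {w : P → EReal} {g : P → ℝ≥0∞} (h : IsUpperGradient w g)
    {γ : ℝ → P} {l s t : ℝ} (hγ : HasUnitSpeedOn γ (Icc 0 l)) (hs : 0 ≤ s) (hst : s < t)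
    (ht : t ≤ l) : (w (γ s) - w (γ t)).abs ≤ ∫⁻ τ in Icc s t, g (γ τ) := by
  have := h.2 (t - s) (fun τ => γ (s + τ)) (by linarith) (hasUnitSpeedOn_shift hγ hs ht)
  simp only [add_zero, add_sub_cancel] at this
  refine this.trans_eq ?_
  have hp := (measurePreserving_add_left (volume : Measure ℝ) s).setLIntegral_comp_preimage_emb
    (measurableEmbedding_addLeft s) (fun τ => g (γ τ)) (Icc s t)
  rw [preimage_const_add_Icc, sub_self] at hp
  exact hp

theorem ereal_abs_sub_lt_top {a b : EReal} (h : (a - b).abs < ∞) :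
    a = a.toReal ∧ b = b.toReal := by
  induction a <;> induction b <;> simp_all

theorem ereal_abs_coe_sub_coe (a b : ℝ) : ((a : EReal) - b).abs = edist a b := by
  rw [← EReal.coe_sub, EReal.abs_def, edist_dist, Real.dist_eq]

/-- An upper gradient may be replaced by a small multiple of itself where the function
vanishes. -/
theorem IsUpperGradient.localize {w : P → EReal} {g G : P → ℝ≥0∞} {L : ℝ≥0}
    (h : IsUpperGradient w fun x => g x + L) (hg : Measurable[borel P] g)
    (hG : Measurable[borel P] G) (hle : ∀ x, w x ≠ 0 → g x + L ≤ G x) {ε : ℝ≥0} (hε : 0 < ε) :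
    IsUpperGradient w fun x => G x + ε * g x := by
  refine ⟨hG.add (hg.const_mul _), fun l γ hl hγ => ?_⟩
  have hε0 : (ε : ℝ≥0∞) ≠ 0 := by exact_mod_cast hε.ne'
  by_cases htop : ∫⁻ t in Icc 0 l, g (γ t) = ∞
  · refine le_top.trans (le_trans (le_of_eq ?_) (lintegral_mono fun t => le_add_self))
    rw [lintegral_const_mul' _ _ ENNReal.coe_ne_top, htop, ENNReal.mul_top hε0]
  set F : ℝ → ℝ≥0∞ := fun t => g (γ t) + L with hF
  have hFfin : ∫⁻ t in Icc 0 l, F t ≠ ∞ := by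
    rw [lintegral_add_right _ measurable_const]
    refine ENNReal.add_ne_top.2 ⟨htop, ?_⟩
    rw [setLIntegral_const, Real.volume_Icc]
    exact ENNReal.mul_ne_top ENNReal.coe_ne_top ENNReal.ofReal_ne_top
  have hsub : ∀ s t, 0 ≤ s → s < t → t ≤ l →
      (w (γ s) - w (γ t)).abs ≤ ∫⁻ τ in Icc s t, F τ := fun s t hs hst ht =>
    h.abs_sub_le hγ hs hst ht
  have hsubfin : ∀ s t, 0 ≤ s → t ≤ l → ∫⁻ τ in Icc s t, F τ < ∞ := fun s t hs ht =>
    (lintegral_mono_set (Icc_subset_Icc hs ht)).trans_lt hFfin.lt_top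
  set φ : ℝ → ℝ := fun t => (w (γ t)).toReal with hφ
  have hreal : ∀ t ∈ Icc 0 l, w (γ t) = φ t := by
    intro t ht
    rcases ht.2.eq_or_lt with rfl | htl
    · exact (ereal_abs_sub_lt_top ((hsub 0 t le_rfl hl le_rfl).trans_lt
        (hsubfin _ _ le_rfl le_rfl))).2
    · exact (ereal_abs_sub_lt_top ((hsub t l ht.1 htl le_rfl).trans_lt
        (hsubfin _ _ ht.1 le_rfl))).1
  have hdist : ∀ s ∈ Icc 0 l, ∀ t ∈ Icc 0 l, s ≤ t →
      edist (φ s) (φ t) ≤ ∫⁻ τ in Icc s t, F τ := by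
    intro s hs t ht hst
    rcases hst.eq_or_lt with rfl | hst
    · simp
    · have := hsub s t hs.1 hst ht.2
      rwa [hreal s hs, hreal t ht, ereal_abs_coe_sub_coe] at this
  have hcont : ContinuousOn φ (Icc 0 l) := by
    intro x hx
    rw [ContinuousWithinAt, tendsto_iff_edist_tendsto_0]
    have hz : Tendsto (fun y => volume.restrict (Icc 0 l) (uIcc x y)) (𝓝[Icc 0 l] x) (𝓝 0) := by
      refine tendsto_of_tendsto_of_tendsto_of_le_of_le tendsto_const_nhds ?_ (fun _ => zero_le)
        (fun y => Measure.restrict_apply_le _ _)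
      simp only [Real.volume_interval]
      have : Continuous fun y => ENNReal.ofReal |y - x| :=
        ENNReal.continuous_ofReal.comp (by fun_prop)
      simpa using (this.tendsto x).mono_left nhdsWithin_le_nhds
    refine tendsto_of_tendsto_of_tendsto_of_le_of_le' tendsto_const_nhds
      (tendsto_setLIntegral_zero hFfin hz) (Eventually.of_forall fun _ => zero_le) ?_
    filter_upwards [self_mem_nhdsWithin] with y hy
    have hI : ∀ s t, 0 ≤ s → t ≤ l → (volume.restrict (Icc 0 l)).restrict (Icc s t) =
        volume.restrict (Icc s t) := fun s t hs ht =>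
      Measure.restrict_restrict_of_subset (Icc_subset_Icc hs ht)
    rcases le_total x y with hxy | hxy
    · rw [uIcc_of_le hxy, hI _ _ hx.1 hy.2, edist_comm]
      exact hdist x hx y hy hxy
    · rw [uIcc_of_ge hxy, hI _ _ hy.1 hx.2]
      exact hdist y hy x hx hxy
  have hFG : ∀ t ∈ Icc 0 l, φ t ≠ 0 → F t ≤ G (γ t) := fun t ht h0 =>
    hle _ (by rw [hreal t ht]; exact_mod_cast h0)
  have h0mem : (0 : ℝ) ∈ Icc 0 l := left_mem_Icc.2 hl.le
  have hlmem : l ∈ Icc 0 l := right_mem_Icc.2 hl.le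
  suffices hmain : edist (φ 0) (φ l) ≤ ∫⁻ t in Icc 0 l, G (γ t) by
    rw [hreal 0 h0mem, hreal l hlmem, ereal_abs_coe_sub_coe]
    exact hmain.trans (lintegral_mono fun t => le_self_add)
  rcases (Icc 0 l ∩ φ ⁻¹' {0}).eq_empty_or_nonempty with hK | hK
  · refine (hdist 0 h0mem l hlmem hl.le).trans (setLIntegral_mono' measurableSet_Icc ?_)
    intro t ht
    refine hFG t ht fun h0 => ?_
    exact (hK ▸ (⟨ht, h0⟩ : t ∈ Icc 0 l ∩ φ ⁻¹' {0}) : t ∈ (∅ : Set ℝ))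
  have hKc : IsCompact (Icc 0 l ∩ φ ⁻¹' {0}) :=
    isCompact_Icc.of_isClosed_subset
      (hcont.preimage_isClosed_of_isClosed isClosed_Icc isClosed_singleton) inter_subset_left
  obtain ⟨a, ha, hamin⟩ := hKc.exists_isLeast hK
  obtain ⟨b, hb, hbmax⟩ := hKc.exists_isGreatest hK
  have hab : a ≤ b := hamin hb
  have ha0 : φ a = 0 := ha.2
  have hb0 : φ b = 0 := hb.2
  calc edist (φ 0) (φ l) ≤ edist (φ 0) (φ a) + edist (φ b) (φ l) := by
        rw [ha0, hb0]
        exact edist_triangle _ _ _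
    _ ≤ (∫⁻ t in Icc 0 a, F t) + ∫⁻ t in Icc b l, F t :=
        add_le_add (hdist 0 h0mem a ha.1 ha.1.1) (hdist b hb.1 l hlmem hb.1.2)
    _ = (∫⁻ t in Ico 0 a, F t) + ∫⁻ t in Ioc b l, F t := by
        rw [setLIntegral_congr Ico_ae_eq_Icc, setLIntegral_congr Ioc_ae_eq_Icc]
    _ ≤ (∫⁻ t in Ico 0 a, G (γ t)) + ∫⁻ t in Ioc b l, G (γ t) := by
        refine add_le_add (setLIntegral_mono' measurableSet_Ico fun t ht => ?_)
          (setLIntegral_mono' measurableSet_Ioc fun t ht => ?_)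
        · have htm : t ∈ Icc 0 l := ⟨ht.1, ht.2.le.trans ha.1.2⟩
          exact hFG t htm fun h0 => ht.2.not_ge (hamin ⟨htm, h0⟩)
        · have htm : t ∈ Icc 0 l := ⟨hb.1.1.trans ht.1.le, ht.2⟩
          exact hFG t htm fun h0 => ht.1.not_ge (hbmax ⟨htm, h0⟩)
    _ = ∫⁻ t in Ico 0 a ∪ Ioc b l, G (γ t) := by
        rw [lintegral_union measurableSet_Ioc]
        exact Set.disjoint_left.2 fun t ht ht' => (ht.2.trans_le hab).not_gt ht'.1
    _ ≤ ∫⁻ t in Icc 0 l, G (γ t) := by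
        refine lintegral_mono_set (union_subset ?_ ?_)
        · exact fun t ht => ⟨ht.1, ht.2.le.trans ha.1.2⟩
        · exact fun t ht => ⟨hb.1.1.trans ht.1.le, ht.2⟩

theorem IsUpperGradient.sub_lipschitz {v f : P → ℝ} {g : P → ℝ≥0∞} {L : ℝ≥0}
    (hv : IsUpperGradient (fun x => (v x : EReal)) g) (hf : LipschitzWith L f) :
    IsUpperGradient (fun x => (v x : EReal) - f x) fun x => g x + L := by
  refine ⟨hv.1.add measurable_const, fun l γ hl hγ => ?_⟩
  change ((v (γ 0) : EReal) - f (γ 0) - ((v (γ l) : EReal) - f (γ l))).abs ≤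
    ∫⁻ t in Icc 0 l, (g (γ t) + L)
  rw [← EReal.coe_sub, ← EReal.coe_sub, ereal_abs_coe_sub_coe]
  have h1 := hv.2 l γ hl hγ
  rw [ereal_abs_coe_sub_coe] at h1
  rw [lintegral_add_right _ measurable_const, setLIntegral_const, Real.volume_Icc, sub_zero]
  calc edist (v (γ 0) - f (γ 0)) (v (γ l) - f (γ l))
      ≤ edist (v (γ 0)) (v (γ l)) + edist (f (γ 0)) (f (γ l)) := by
        simp only [edist_dist, Real.dist_eq]
        rw [← ENNReal.ofReal_add (abs_nonneg _) (abs_nonneg _)]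
        refine ENNReal.ofReal_le_ofReal ?_
        rw [show v (γ 0) - f (γ 0) - (v (γ l) - f (γ l)) =
          v (γ 0) - v (γ l) - (f (γ 0) - f (γ l)) by ring]
        exact abs_sub _ _
    _ ≤ _ := by
        refine add_le_add h1 ((hf _ _).trans ?_)
        gcongr
        exact edist_le_of_hasUnitSpeedOn hl.le hγ

theorem IsUpperGradient.of_abs_sub_le {u w : P → EReal} {g : P → ℝ≥0∞} (h : IsUpperGradient u g)
    (hw : ∀ x y, (w x - w y).abs ≤ (u x - u y).abs) : IsUpperGradient w g :=
  ⟨h.1, fun l γ hl hγ => (hw _ _).trans (h.2 l γ hl hγ)⟩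

end Curves

section NewtonianNorm

variable {P : Type*} [MetricSpace P] [MeasurableSpace P] [BorelSpace P] {μ : Measure P}
  {N : (P → EReal) → ℝ≥0∞}

theorem IsUpperGradient.measurable {u : P → EReal} {g : P → ℝ≥0∞} (h : IsUpperGradient u g) :
    Measurable g := by
  rw [BorelSpace.measurable_eq (α := P)]
  exact h.1

/-- The Newtonian norm only sees an upper gradient on a set outside of which the function
vanishes a.e. -/
theorem newtonianNorm_le_of_ae_eq_zero (hX : IsBanachFunctionLattice μ N) {w : P → EReal}
    {g : P → ℝ≥0∞} {L : ℝ≥0} (h : IsUpperGradient w fun x => g x + L) (hg : Measurable g)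
    (hfin : posNorm N g < ∞) {F : Set P} (hF : NullMeasurableSet F μ)
    (hw : ∀ᵐ x ∂μ, x ∉ F → w x = 0) :
    newtonianNorm N w ≤ N w + posNorm N (F.indicator fun x => g x + L) := by
  set S : Set P := F ∪ {x | w x ≠ 0} with hS
  have hSF : S =ᵐ[μ] F := by
    refine eventuallyLE_antisymm_iff.2 ⟨?_, ?_⟩
    · filter_upwards [hw] with x hx hxS
      by_contra hxF
      rcases hxS with h | h
      · exact hxF h
      · exact h (hx hxF)
    · exact Eventually.of_forall fun x hx => Or.inl hx
  set T := toMeasurable μ S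
  have hTF : T =ᵐ[μ] F := (hF.congr hSF.symm).toMeasurable_ae_eq.trans hSF
  have hTm : MeasurableSet T := measurableSet_toMeasurable _ _
  have hGm : Measurable (T.indicator fun x => g x + L) := (hg.add measurable_const).indicator hTm
  have hnorm : posNorm N (F.indicator fun x => g x + L) =
      posNorm N (T.indicator fun x => g x + L) :=
    (posNorm_congr hX hGm.aemeasurable (indicator_ae_eq_of_ae_eq_set hTF)).symm
  rw [hnorm]
  refine add_le_add le_rfl (ENNReal.le_of_forall_pos_le_add fun δ hδ _ => ?_)
  set B := (posNorm N g).toNNReal with hB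
  have hBg : posNorm N g = B := (ENNReal.coe_toNNReal hfin.ne).symm
  have hεpos : 0 < δ / (B + 1) := by positivity
  have hug : IsUpperGradient w
      fun x => T.indicator (fun x => g x + L) x + (δ / (B + 1) : ℝ≥0) * g x := by
    have hb : ‹MeasurableSpace P› = borel P := BorelSpace.measurable_eq
    refine h.localize (by rw [← hb]; exact hg) (by rw [← hb]; exact hGm) (fun x hx => ?_) hεpos
    rw [indicator_of_mem (subset_toMeasurable μ S (Or.inr hx))]
  refine (iInf₂_le _ hug).trans ?_
  refine (posNorm_add_le hX hGm.aemeasurable (hg.const_mul _).aemeasurable).trans ?_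
  rw [posNorm_const_mul hX hg.aemeasurable, hBg]
  gcongr
  rw [← ENNReal.coe_mul, ENNReal.coe_le_coe, div_mul_eq_mul_div]
  refine div_le_of_le_mul₀ (by positivity) (by positivity) ?_
  gcongr
  exact le_self_add

theorem newtonianNorm_add_le (hX : IsBanachFunctionLattice μ N) {u v w : P → EReal}
    (hv : AEMeasurable v μ) (hw : AEMeasurable w μ)
    (hu : AEMeasurable u μ) (habs : ∀ x, (u x).abs ≤ (v x).abs + (w x).abs)
    (hsub : ∀ x y, (u x - u y).abs ≤ (v x - v y).abs + (w x - w y).abs) :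
    newtonianNorm N u ≤ newtonianNorm N v + newtonianNorm N w := by
  have habsm : ∀ {f : P → EReal}, AEMeasurable f μ → AEMeasurable (fun x => (f x).abs) μ :=
    fun hf => measurable_ereal_abs.comp_aemeasurable hf
  have h1 : N u ≤ N v + N w := by
    rw [norm_eq_posNorm_abs hX hu, norm_eq_posNorm_abs hX hv, norm_eq_posNorm_abs hX hw]
    exact (posNorm_mono hX (habsm hu) ((habsm hv).add (habsm hw))
      (Eventually.of_forall habs)).trans (posNorm_add_le hX (habsm hv) (habsm hw))
  have h2 : (⨅ (g : P → ℝ≥0∞) (_ : IsUpperGradient u g), posNorm N g) ≤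
      (⨅ (g : P → ℝ≥0∞) (_ : IsUpperGradient v g), posNorm N g) +
        ⨅ (g : P → ℝ≥0∞) (_ : IsUpperGradient w g), posNorm N g := by
    refine ENNReal.le_iInf₂_add_iInf₂ fun g hg g' hg' => ?_
    refine (iInf₂_le (fun x => g x + g' x) ⟨hg.1.add hg'.1, fun l γ hl hγ => ?_⟩).trans
      (posNorm_add_le hX hg.measurable.aemeasurable hg'.measurable.aemeasurable)
    exact (hsub _ _).trans ((add_le_add (hg.2 l γ hl hγ) (hg'.2 l γ hl hγ)).trans
      (le_lintegral_add _ _))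
  calc newtonianNorm N u ≤ _ := add_le_add h1 h2
    _ = _ := by rw [newtonianNorm, newtonianNorm]; simp only [posNorm]; ring

end NewtonianNorm

section Lipschitz

variable {P : Type*} [MeasurableSpace P] {μ : Measure P}

theorem edist_setAverage_le {S B : Set P} (hSB : S ⊆ B) (hS0 : μ S ≠ 0)
    (hBfin : μ B ≠ ∞) {v : P → ℝ} (hv : IntegrableOn v B μ) (m : ℝ) {D : ℝ≥0}
    (hD : μ B ≤ D * μ S) {M : ℝ≥0∞} (hM : ⨍⁻ x in B, edist (v x) m ∂μ ≤ M) :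
    edist (⨍ x in S, v x ∂μ) m ≤ D * M := by
  have hSfin : μ S ≠ ∞ := ((measure_mono hSB).trans_lt hBfin.lt_top).ne
  have hfin : IsFiniteMeasure (μ.restrict S) := ⟨by simpa using hSfin.lt_top⟩
  have hne : NeZero (μ.restrict S) := ⟨by simpa using hS0⟩
  have hvint : Integrable v (μ.restrict S) := hv.mono_set hSB
  have h1 : (⨍ x in S, v x ∂μ) - m = ⨍ x in S, (v x - m) ∂μ := by
    rw [average, average, integral_sub, integral_const]
    · simp [Measure.real, inv_mul_cancel₀ (ENNReal.toReal_ne_zero.2 ⟨hS0, hSfin⟩)]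
    · exact hvint.to_average
    · exact integrable_const _
  have hB0 : μ B ≠ 0 := fun h => hS0 (measure_mono_null hSB h)
  rw [edist_eq_enorm_sub, h1]
  calc ‖⨍ x in S, (v x - m) ∂μ‖ₑ ≤ ⨍⁻ x in S, ‖v x - m‖ₑ ∂μ :=
        enorm_integral_le_lintegral_enorm _
    _ = (∫⁻ x in S, edist (v x) m ∂μ) / μ S := by
        rw [setLAverage_eq]
        simp only [edist_eq_enorm_sub]
    _ ≤ (D * μ S * M) / μ S := by
        gcongr
        refine (lintegral_mono_set hSB).trans ?_
        rw [← measure_mul_setLAverage _ hBfin]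
        gcongr
    _ = D * M := by
        rw [mul_right_comm, ENNReal.mul_div_cancel_right hS0 hSfin]

variable [MetricSpace P]

/-- The oscillation estimate that the Poincaré inequality yields for a bounded function. -/
theorem laverage_edist_le {c : ℝ≥0} {lam : ℝ} (hlam : 1 ≤ lam)
    (hPI : ∀ (u : P → EReal) (g : P → ℝ≥0∞), AEMeasurable u μ →
      (∀ (x : P) (r : ℝ), 0 < r → ∫⁻ y in Metric.ball x r, (u y).abs ∂μ < ∞) →
      IsUpperGradient u g →
      ∀ (x : P) (r : ℝ), 0 < r →
        ⨍⁻ y in Metric.ball x r,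
            (u y - ((⨍ z in Metric.ball x r, (u z).toReal ∂μ : ℝ) : EReal)).abs ∂μ
          ≤ c * Metric.ediam (Metric.ball x r) *
            (⨍⁻ y in Metric.ball x (lam * r), g y ^ (1 : ℝ) ∂μ) ^ (1 / (1 : ℝ)))
    (hball : ∀ (x : P) (r : ℝ), 0 < r → 0 < μ (Metric.ball x r) ∧ μ (Metric.ball x r) < ∞)
    {v : P → ℝ} (hv : AEMeasurable v μ) {k : ℝ≥0} (hk : ∀ x, |v x| ≤ k) {g : P → ℝ≥0∞}
    (hg : IsUpperGradient (fun x => (v x : EReal)) g) {σ : ℝ≥0} {x : P}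
    (hx : ∀ s : ℝ, 0 < s → s ≤ 1 →
      ∫⁻ y in Metric.ball x s, g y ∂μ ≤ σ * μ (Metric.ball x s))
    {ρ : ℝ} (hρ : 0 < ρ) (hρ1 : lam * ρ ≤ 1) :
    ⨍⁻ y in Metric.ball x ρ, edist (v y) (⨍ z in Metric.ball x ρ, v z ∂μ) ∂μ ≤
      c * ENNReal.ofReal (2 * ρ) * σ := by
  have hb : ∀ (x : P) (r : ℝ), 0 < r → ∫⁻ y in Metric.ball x r, (v y : EReal).abs ∂μ < ∞ := by
    intro x r hr
    calc ∫⁻ y in Metric.ball x r, (v y : EReal).abs ∂μ ≤ ∫⁻ y in Metric.ball x r, k ∂μ := by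
          refine lintegral_mono fun y => ?_
          rw [EReal.abs_def]
          exact ENNReal.ofReal_le_of_le_toReal (hk y)
      _ = k * μ (Metric.ball x r) := setLIntegral_const _ _
      _ < ∞ := ENNReal.mul_lt_top ENNReal.coe_lt_top (hball x r hr).2
  have h := hPI (fun x => (v x : EReal)) g hv.coe_real_ereal hb hg x ρ hρ
  simp only [EReal.toReal_coe, ereal_abs_coe_sub_coe, ENNReal.rpow_one, div_one] at h
  refine h.trans ?_
  have hlρ : 0 < lam * ρ := by positivity
  gcongr
  · rw [← Metric.eball_ofReal, ENNReal.ofReal_mul zero_le_two, ENNReal.ofReal_ofNat]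
    exact Metric.ediam_eball_le
  · rw [setLAverage_eq]
    exact ENNReal.div_le_of_le_mul (hx _ hlρ hρ1)

theorem isUnifLocDoublingMeasure_of_ball {C : ℝ≥0} (hC : ∀ (x : P) (r : ℝ), 0 < r →
      μ (Metric.ball x (2 * r)) ≤ C * μ (Metric.ball x r)) : IsUnifLocDoublingMeasure μ := by
  refine ⟨C ^ 2, ?_⟩
  filter_upwards [self_mem_nhdsWithin] with r hr x
  have hr : 0 < r := hr
  calc μ (Metric.closedBall x (2 * r)) ≤ μ (Metric.ball x (2 * (2 * r))) :=
        measure_mono (Metric.closedBall_subset_ball (by linarith))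
    _ ≤ C * (C * μ (Metric.ball x r)) := by
        refine (hC _ _ (by positivity)).trans ?_
        gcongr
        exact hC _ _ hr
    _ ≤ C * (C * μ (Metric.closedBall x r)) := by
        gcongr
        exact Metric.ball_subset_closedBall
    _ = _ := by push_cast; ring

theorem locallyIntegrable_of_bounded
    (hball : ∀ (x : P) (r : ℝ), 0 < r → 0 < μ (Metric.ball x r) ∧ μ (Metric.ball x r) < ∞)
    {v : P → ℝ} (hv : AEMeasurable v μ) {k : ℝ≥0} (hk : ∀ x, |v x| ≤ k) (x : P) {r : ℝ}
    (hr : 0 < r) : IntegrableOn v (Metric.ball x r) μ :=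
  Measure.integrableOn_of_bounded (hball x r hr).2.ne hv.aestronglyMeasurable
    (M := k) (Eventually.of_forall hk)

/-- Telescoping: a bound on the oscillation over all small balls around a Lebesgue point controls
the distance of its value to the average over a ball. -/
theorem dist_setAverage_le_of_tendsto {C : ℝ≥0} (hC : ∀ (x : P) (r : ℝ), 0 < r →
      μ (Metric.ball x (2 * r)) ≤ C * μ (Metric.ball x r))
    (hball : ∀ (x : P) (r : ℝ), 0 < r → 0 < μ (Metric.ball x r) ∧ μ (Metric.ball x r) < ∞)
    {v : P → ℝ} (hv : ∀ (x : P) (r : ℝ), 0 < r → IntegrableOn v (Metric.ball x r) μ)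
    {M : ℝ≥0} {x : P} {r : ℝ} (hr : 0 < r)
    (hosc : ∀ ρ : ℝ, 0 < ρ → ρ ≤ 2 * r →
      ⨍⁻ y in Metric.ball x ρ, edist (v y) (⨍ z in Metric.ball x ρ, v z ∂μ) ∂μ ≤
        ENNReal.ofReal (M * ρ))
    (hlim : Tendsto (fun s => ⨍ y in Metric.closedBall x s, v y ∂μ) (𝓝[>] 0) (𝓝 (v x))) :
    dist (⨍ y in Metric.closedBall x r, v y ∂μ) (v x) ≤ 4 * (C + C ^ 2) * M * r := by
  set a : ℕ → ℝ := fun j => ⨍ y in Metric.closedBall x (r / 2 ^ j), v y ∂μ with ha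
  have hpos : ∀ j : ℕ, 0 < r / 2 ^ j := fun j => by positivity
  have hcomp : ∀ (s ρ : ℝ) (D : ℝ≥0), 0 < s → s < ρ → ρ ≤ 2 * r →
      μ (Metric.ball x ρ) ≤ D * μ (Metric.ball x s) →
      dist (⨍ y in Metric.closedBall x s, v y ∂μ) (⨍ z in Metric.ball x ρ, v z ∂μ) ≤
        D * (M * ρ) := by
    intro s ρ D hs hsρ hρ hD
    have hρ0 : 0 < ρ := hs.trans hsρ
    have := edist_setAverage_le (μ := μ) (Metric.closedBall_subset_ball hsρ)
      ((hball x s hs).1.trans_le (measure_mono Metric.ball_subset_closedBall)).ne'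
      (hball x ρ hρ0).2.ne (hv x ρ hρ0) _ (hD.trans (by gcongr; exact Metric.ball_subset_closedBall))
      (hosc ρ hρ0 hρ)
    rw [← ENNReal.ofReal_coe_nnreal, ← ENNReal.ofReal_mul D.coe_nonneg] at this
    exact (edist_le_ofReal (by positivity)).1 this
  have hstep : ∀ j, dist (a j) (a (j + 1)) ≤ 4 * (C + C ^ 2) * M * r / 2 / 2 ^ j := by
    intro j
    have hle : 2 * (r / 2 ^ j) ≤ 2 * r := by
      have : r / 2 ^ j ≤ r := div_le_self hr.le (one_le_pow₀ one_le_two)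
      linarith
    have hhalf : r / 2 ^ j = 2 * (r / 2 ^ (j + 1)) := by
      rw [pow_succ]
      field_simp
    have h1 := hcomp (r / 2 ^ j) (2 * (r / 2 ^ j)) C (hpos j) (by linarith [hpos j]) hle
      (hC _ _ (hpos j))
    have h2 := hcomp (r / 2 ^ (j + 1)) (2 * (r / 2 ^ j)) (C ^ 2) (hpos _)
      (by linarith [hpos (j + 1)]) hle (by
        refine (hC _ _ (hpos j)).trans ?_
        rw [hhalf, pow_two, ENNReal.coe_mul, mul_assoc]
        gcongr
        exact hC _ _ (hpos _))
    calc dist (a j) (a (j + 1)) ≤ _ := dist_triangle_right _ _ _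
      _ ≤ _ := add_le_add h1 h2
      _ = 4 * (C + C ^ 2) * M * r / 2 / 2 ^ j := by
        push_cast
        ring
  have hlim' : Tendsto a atTop (𝓝 (v x)) := by
    refine hlim.comp (tendsto_nhdsWithin_iff.2 ⟨?_, Eventually.of_forall hpos⟩)
    exact tendsto_const_nhds.div_atTop (tendsto_pow_atTop_atTop_of_one_lt one_lt_two)
  have := dist_le_of_le_geometric_two_of_tendsto₀ hstep hlim'
  simpa [ha] using this

/-- A bounded function is Lipschitz on the set of Lebesgue points at which the maximal function
of an upper gradient is bounded. -/
theorem dist_le_of_maximal_le {C : ℝ≥0} (hC1 : 1 ≤ C) (hC : ∀ (x : P) (r : ℝ), 0 < r →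
      μ (Metric.ball x (2 * r)) ≤ C * μ (Metric.ball x r))
    (hball : ∀ (x : P) (r : ℝ), 0 < r → 0 < μ (Metric.ball x r) ∧ μ (Metric.ball x r) < ∞)
    {v : P → ℝ} (hv : ∀ (x : P) (r : ℝ), 0 < r → IntegrableOn v (Metric.ball x r) μ)
    {M : ℝ≥0} {R : ℝ} {x y : P} (hxy : 4 * dist x y ≤ R)
    (hosc : ∀ z ∈ ({x, y} : Set P), ∀ ρ : ℝ, 0 < ρ → ρ ≤ R →
      ⨍⁻ y in Metric.ball z ρ, edist (v y) (⨍ z in Metric.ball z ρ, v z ∂μ) ∂μ ≤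
        ENNReal.ofReal (M * ρ))
    (hlim : ∀ z ∈ ({x, y} : Set P),
      Tendsto (fun s => ⨍ y in Metric.closedBall z s, v y ∂μ) (𝓝[>] 0) (𝓝 (v z))) :
    dist (v x) (v y) ≤ 24 * C ^ 3 * M * dist x y := by
  rcases eq_or_ne x y with rfl | hne
  · simp
  set r := dist x y with hr
  have hr0 : 0 < r := dist_pos.2 hne
  have htel : ∀ z ∈ ({x, y} : Set P),
      dist (⨍ y in Metric.closedBall z r, v y ∂μ) (v z) ≤ 4 * (C + C ^ 2) * M * r := fun z hz =>
    dist_setAverage_le_of_tendsto hC hball hv hr0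
      (fun ρ hρ hρr => hosc z hz ρ hρ (by linarith)) (hlim z hz)
  have h2 : ∀ z s, 0 < s → μ (Metric.ball z (4 * s)) ≤ (C ^ 2 : ℝ≥0) * μ (Metric.ball z s) := by
    intro z s hs
    rw [show 4 * s = 2 * (2 * s) by ring, pow_two, ENNReal.coe_mul, mul_assoc]
    refine (hC _ _ (by positivity)).trans ?_
    gcongr
    exact hC _ _ hs
  have hcomp : ∀ (z : P) (D : ℝ≥0), Metric.closedBall z r ⊆ Metric.ball x (4 * r) →
      μ (Metric.ball x (4 * r)) ≤ D * μ (Metric.ball z r) →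
      dist (⨍ y in Metric.closedBall z r, v y ∂μ) (⨍ w in Metric.ball x (4 * r), v w ∂μ) ≤
        D * (M * (4 * r)) := by
    intro z D hsub hD
    have hρ0 : 0 < 4 * r := by positivity
    have := edist_setAverage_le (μ := μ) hsub
      ((hball z r hr0).1.trans_le (measure_mono Metric.ball_subset_closedBall)).ne'
      (hball x _ hρ0).2.ne (hv x _ hρ0) _ (hD.trans (by gcongr; exact Metric.ball_subset_closedBall))
      (hosc x (by simp) _ hρ0 hxy)
    rw [← ENNReal.ofReal_coe_nnreal, ← ENNReal.ofReal_mul D.coe_nonneg] at this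
    exact (edist_le_ofReal (by positivity)).1 this
  have hx := hcomp x (C ^ 2) (Metric.closedBall_subset_ball (by linarith)) (h2 x r hr0)
  have hy := hcomp y (C ^ 3) (fun z hz => by
      rw [Metric.mem_closedBall] at hz
      rw [Metric.mem_ball]
      have := dist_triangle z y x
      rw [dist_comm y x] at this
      linarith) (by
      calc μ (Metric.ball x (4 * r)) ≤ μ (Metric.ball y (2 * (4 * r))) := by
            refine measure_mono (Metric.ball_subset_ball' ?_)
            linarith
        _ ≤ C * ((C ^ 2 : ℝ≥0) * μ (Metric.ball y r)) := by
            refine (hC _ _ (by positivity)).trans ?_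
            gcongr
            exact h2 y r hr0
        _ = _ := by push_cast; ring)
  have hx' := htel x (by simp)
  have hy' := htel y (by simp)
  have hC1' : (1 : ℝ) ≤ C := by exact_mod_cast hC1
  have hMr : 0 ≤ M * r := by positivity
  have e1 : (C : ℝ) ≤ C ^ 3 := le_self_pow₀ hC1' (by norm_num)
  have e2 : (C : ℝ) ^ 2 ≤ C ^ 3 := pow_le_pow_right₀ hC1' (by norm_num)
  have e3 := mul_le_mul_of_nonneg_right e1 hMr
  have e4 := mul_le_mul_of_nonneg_right e2 hMr
  push_cast at hx hy
  set A := ⨍ y in Metric.closedBall x r, v y ∂μ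
  set B := ⨍ z in Metric.closedBall y r, v z ∂μ
  set m := ⨍ w in Metric.ball x (4 * r), v w ∂μ
  have t1 := dist_triangle (v x) A (v y)
  have t2 := dist_triangle A m (v y)
  have t3 := dist_triangle m B (v y)
  rw [dist_comm (v x) A] at t1
  rw [dist_comm m B] at t3
  nlinarith

end Lipschitz

section Clamp

/-- Truncation of an extended real number at the levels `±k`. -/
noncomputable def clamp (k : ℝ) (a : EReal) : ℝ := (max (min a k) (-k : ℝ)).toReal

theorem clamp_coe (k a : ℝ) : clamp k a = max (min a k) (-k) := by
  have h : max (min (a : EReal) k) (-k : ℝ) = (max (min a k) (-k) : ℝ) := by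
    rw [EReal.coe_strictMono.monotone.map_max, EReal.coe_strictMono.monotone.map_min]
  rw [clamp, h, EReal.toReal_coe]

theorem measurable_clamp (k : ℝ) : Measurable (clamp k) :=
  ((measurable_id.min measurable_const).max measurable_const).ereal_toReal

theorem abs_clamp_le {k : ℝ} (hk : 0 ≤ k) (a : EReal) : |clamp k a| ≤ k := by
  induction a with
  | bot => simp [clamp, abs_of_nonneg hk]
  | top =>
    have h : max (min (⊤ : EReal) k) (-k : ℝ) = (k : ℝ) := by
      rw [min_eq_right le_top, max_eq_left (EReal.coe_le_coe_iff.2 (by linarith))]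
    rw [clamp, h, EReal.toReal_coe, abs_of_nonneg hk]
  | coe a =>
    rw [clamp_coe, abs_le]
    exact ⟨le_max_right _ _, max_le (min_le_right _ _) (by linarith)⟩

theorem abs_clamp_sub_clamp_le (k : ℝ) (a b : EReal) :
    ((clamp k a : EReal) - clamp k b).abs ≤ (a - b).abs := by
  by_cases h : (a - b).abs < ∞
  · obtain ⟨ha, hb⟩ := ereal_abs_sub_lt_top h
    rw [ha, hb, clamp_coe, clamp_coe, ← EReal.coe_sub, ← EReal.coe_sub, EReal.abs_def,
      EReal.abs_def]
    refine ENNReal.ofReal_le_ofReal ?_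
    grind
  · rw [not_lt_top_iff.1 h]
    exact le_top

theorem abs_sub_clamp_sub_le {k : ℝ} (hk : 0 ≤ k) (a b : EReal) :
    (a - clamp k a - (b - clamp k b)).abs ≤ (a - b).abs := by
  by_cases h : (a - b).abs < ∞
  · obtain ⟨ha, hb⟩ := ereal_abs_sub_lt_top h
    rw [ha, hb, clamp_coe, clamp_coe, ← EReal.coe_sub, ← EReal.coe_sub, ← EReal.coe_sub,
      ← EReal.coe_sub, EReal.abs_def, EReal.abs_def]
    refine ENNReal.ofReal_le_ofReal ?_
    grind
  · rw [not_lt_top_iff.1 h]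
    exact le_top

theorem abs_clamp_le_abs {k : ℝ} (hk : 0 ≤ k) (a : EReal) : (clamp k a : EReal).abs ≤ a.abs := by
  have h0 : clamp k 0 = 0 := by simpa [hk] using clamp_coe k 0
  simpa [h0] using abs_clamp_sub_clamp_le k a 0

theorem abs_sub_clamp_le {k : ℝ} (hk : 0 ≤ k) (a : EReal) : (a - clamp k a).abs ≤ a.abs := by
  induction a with
  | bot => simp
  | top => simp
  | coe a =>
    rw [clamp_coe, ← EReal.coe_sub, EReal.abs_def, EReal.abs_def]
    refine ENNReal.ofReal_le_ofReal ?_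
    grind

theorem sub_clamp_eq_zero {k : ℝ≥0} {a : EReal} (h : a.abs ≤ k) : a - clamp k a = 0 := by
  induction a with
  | bot => simp at h
  | top => simp at h
  | coe a =>
    rw [EReal.abs_def] at h
    have h' := ENNReal.toReal_mono ENNReal.coe_ne_top h
    rw [ENNReal.toReal_ofReal (abs_nonneg _), ENNReal.coe_toReal, abs_le] at h'
    rw [clamp_coe, min_eq_left h'.2, max_eq_left h'.1, ← EReal.coe_sub, sub_self, EReal.coe_zero]

end Clamp

section Density

variable {P : Type*} [MetricSpace P] [MeasurableSpace P] [BorelSpace P] {μ : Measure P}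
  {N : (P → EReal) → ℝ≥0∞}

theorem ae_lt_top_of_posNorm_lt_top (hX : IsBanachFunctionSpace μ N)
    (hball : ∀ (x : P) (r : ℝ), 0 < r → 0 < μ (Metric.ball x r) ∧ μ (Metric.ball x r) < ∞)
    {f : P → ℝ≥0∞} (hf : AEMeasurable f μ) (hfin : posNorm N f < ∞) : ∀ᵐ x ∂μ, f x < ∞ := by
  rcases isEmpty_or_nonempty P with hP | ⟨⟨x₀⟩⟩
  · exact Eventually.of_forall fun x => hP.elim x
  have hcover : (⋃ n : ℕ, Metric.ball x₀ (n + 1)) = univ :=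
    eq_univ_of_forall fun x => mem_iUnion.2 <| by
      obtain ⟨n, hn⟩ := exists_nat_gt (dist x x₀)
      exact ⟨n, by rw [Metric.mem_ball]; linarith⟩
  rw [← Measure.restrict_univ (μ := μ), ← hcover, ae_restrict_iUnion_iff]
  intro n
  obtain ⟨C, -, hC⟩ := hX.lintegral_le (Metric.ball x₀ (n + 1))
    measurableSet_ball.nullMeasurableSet (hball _ _ (by positivity)).2
  have h := hC _ hf.coe_ereal_ennreal
  simp only [ereal_abs_coe_ennreal] at h
  exact ae_lt_top' hf.restrict
    (h.trans_lt (ENNReal.mul_lt_top ENNReal.coe_lt_top hfin)).ne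

theorem tendsto_posNorm_indicator_lt (hX : IsBanachFunctionSpace μ N)
    (hAC : HasAbsolutelyContinuousNorm μ N)
    (hball : ∀ (x : P) (r : ℝ), 0 < r → 0 < μ (Metric.ball x r) ∧ μ (Metric.ball x r) < ∞)
    {f h : P → ℝ≥0∞} (hf : AEMeasurable f μ) (hfin : posNorm N f < ∞)
    (hh : AEMeasurable h μ) (hhfin : posNorm N h < ∞) :
    Tendsto (fun n : ℕ => posNorm N ({x | (n : ℝ≥0∞) < h x}.indicator f)) atTop (𝓝 0) := by
  refine tendsto_posNorm_indicator hAC hf hfin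
    (fun n => nullMeasurableSet_lt aemeasurable_const hh) ?_ ?_
  · intro m n hmn x hx
    change (m : ℝ≥0∞) < h x
    exact lt_of_le_of_lt (Nat.cast_le.2 hmn) (show (n : ℝ≥0∞) < h x from hx)
  · have := ae_lt_top_of_posNorm_lt_top hX hball hh hhfin
    refine measure_mono_null (fun x hx => ?_) (ae_iff.1 this)
    rw [mem_iInter] at hx
    intro hlt
    obtain ⟨n, hn⟩ := ENNReal.exists_nat_gt hlt.ne
    exact hn.not_gt (hx n)

/-- Truncations approximate in the Newtonian norm. -/
theorem tendsto_newtonianNorm_sub_clamp (hX : IsBanachFunctionSpace μ N)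
    (hAC : HasAbsolutelyContinuousNorm μ N)
    (hball : ∀ (x : P) (r : ℝ), 0 < r → 0 < μ (Metric.ball x r) ∧ μ (Metric.ball x r) < ∞)
    {u : P → EReal} (hu : AEMeasurable u μ) (hufin : N u < ∞) {g : P → ℝ≥0∞}
    (hg : IsUpperGradient u g) (hgfin : posNorm N g < ∞) :
    Tendsto (fun n : ℕ => newtonianNorm N fun x => u x - clamp n (u x)) atTop (𝓝 0) := by
  have hL := hX.toIsBanachFunctionLattice
  have hau : AEMeasurable (fun x => (u x).abs) μ := measurable_ereal_abs.comp_aemeasurable hu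
  have haufin : posNorm N (fun x => (u x).abs) < ∞ := by rwa [← norm_eq_posNorm_abs hL hu]
  have h1 := tendsto_posNorm_indicator_lt hX hAC hball hau haufin hau haufin
  have h2 := tendsto_posNorm_indicator_lt hX hAC hball hg.measurable.aemeasurable hgfin hau haufin
  refine tendsto_of_tendsto_of_tendsto_of_le_of_le tendsto_const_nhds
    (by simpa using h1.add h2) (fun _ => zero_le) fun n => ?_
  have hn : (0 : ℝ) ≤ n := n.cast_nonneg
  have hEm : NullMeasurableSet {x | (n : ℝ≥0∞) < (u x).abs} μ :=
    nullMeasurableSet_lt aemeasurable_const hau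
  have hwm : AEMeasurable (fun x => u x - clamp n (u x)) μ := by
    simp only [sub_eq_add_neg, ← EReal.coe_neg]
    exact hu.add (((measurable_clamp n).comp_aemeasurable hu).neg.coe_real_ereal)
  have hzero : ∀ x, x ∉ {x | (n : ℝ≥0∞) < (u x).abs} → u x - clamp n (u x) = 0 := by
    intro x hx
    have hx' : (u x).abs ≤ ((n : ℝ≥0) : ℝ≥0∞) := by simpa using hx
    simpa using sub_clamp_eq_zero hx'
  have hwg : IsUpperGradient (fun x => u x - clamp n (u x)) fun x => g x + (0 : ℝ≥0) := by
    simpa using hg.of_abs_sub_le fun x y => abs_sub_clamp_sub_le hn (u x) (u y)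
  refine (newtonianNorm_le_of_ae_eq_zero hL hwg hg.measurable hgfin hEm
    (Eventually.of_forall hzero)).trans (add_le_add ?_ (by simp))
  rw [norm_eq_posNorm_abs hL hwm]
  refine posNorm_mono hL (measurable_ereal_abs.comp_aemeasurable hwm) (hau.indicator₀ hEm)
    (Eventually.of_forall fun x => ?_)
  by_cases hx : x ∈ {x | (n : ℝ≥0∞) < (u x).abs}
  · rw [indicator_of_mem hx]
    exact abs_sub_clamp_le hn _
  · simp [hzero x hx]

/-- Quantitative Lipschitz approximation of a bounded function at level `σ`. -/
theorem exists_lipschitz_newtonianNorm_sub_le [SecondCountableTopology P] [NullSingletonClass μ]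
    (hX : IsRearrangementInvariantSpace μ N)
    (hball : ∀ (x : P) (r : ℝ), 0 < r → 0 < μ (Metric.ball x r) ∧ μ (Metric.ball x r) < ∞)
    {C : ℝ≥0} (hC1 : 1 ≤ C) (hC : ∀ (x : P) (r : ℝ), 0 < r →
      μ (Metric.ball x (2 * r)) ≤ C * μ (Metric.ball x r))
    {c : ℝ≥0} {lam : ℝ≥0} (hlam : (1 : ℝ) ≤ lam)
    (hPI : ∀ (u : P → EReal) (g : P → ℝ≥0∞), AEMeasurable u μ →
      (∀ (x : P) (r : ℝ), 0 < r → ∫⁻ y in Metric.ball x r, (u y).abs ∂μ < ∞) →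
      IsUpperGradient u g →
      ∀ (x : P) (r : ℝ), 0 < r →
        ⨍⁻ y in Metric.ball x r,
            (u y - ((⨍ z in Metric.ball x r, (u z).toReal ∂μ : ℝ) : EReal)).abs ∂μ
          ≤ c * Metric.ediam (Metric.ball x r) *
            (⨍⁻ y in Metric.ball x (lam * r), g y ^ (1 : ℝ) ∂μ) ^ (1 / (1 : ℝ)))
    {v : P → ℝ} (hv : AEMeasurable v μ) {k : ℝ≥0} (hk : ∀ x, |v x| ≤ k) {g : P → ℝ≥0∞}
    (hg : IsUpperGradient (fun x => (v x : EReal)) g) (hgfin : posNorm N g < ∞)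
    {σ : ℝ≥0} (hσ : k ≤ σ) :
    ∃ (f : P → ℝ) (L : ℝ≥0), LipschitzWith L f ∧
      newtonianNorm N (fun x => (v x : EReal) - f x) ≤
        (1 + (3 + (96 * C ^ 3 * c + 8 * lam)) * (⌈C ^ 3⌉₊ * 8) : ℝ≥0) *
          posNorm N ({x | (σ : ℝ≥0∞) < g x}.indicator g) := by
  have hLat := hX.toIsBanachFunctionLattice
  set L₀ : ℝ≥0 := 96 * C ^ 3 * c + 8 * lam with hL₀
  set g₁ : P → ℝ≥0∞ := {x | (σ : ℝ≥0∞) < g x}.indicator g with hg₁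
  have hgm : Measurable g := hg.measurable
  have hg₁m : Measurable g₁ := hgm.indicator (measurableSet_lt measurable_const hgm)
  obtain ⟨E, hEo, hEgood, hEnorm⟩ := exists_isOpen_weak_type hX hball hC hg₁m σ
  have hEm : MeasurableSet E := hEo.measurableSet
  have hgg₁ : ∀ x, g x ≤ g₁ x + σ := by
    intro x
    by_cases hx : (σ : ℝ≥0∞) < g x
    · rw [hg₁, indicator_of_mem (show x ∈ {x | (σ : ℝ≥0∞) < g x} from hx)]
      exact le_self_add
    · exact (not_lt.1 hx).trans le_add_self
  have hgood : ∀ x ∉ E, ∀ s : ℝ, 0 < s → s ≤ 1 →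
      ∫⁻ y in Metric.ball x s, g y ∂μ ≤ (2 * σ : ℝ≥0) * μ (Metric.ball x s) := by
    intro x hx s hs hs1
    calc ∫⁻ y in Metric.ball x s, g y ∂μ ≤ ∫⁻ y in Metric.ball x s, (g₁ y + σ) ∂μ :=
          lintegral_mono hgg₁
      _ = ∫⁻ y in Metric.ball x s, g₁ y ∂μ + σ * μ (Metric.ball x s) := by
          rw [lintegral_add_right _ measurable_const, setLIntegral_const]
      _ ≤ σ * μ (Metric.ball x s) + σ * μ (Metric.ball x s) :=
          add_le_add (hEgood x hx s hs hs1) le_rfl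
      _ = _ := by push_cast; ring
  have hvint : ∀ (x : P) (r : ℝ), 0 < r → IntegrableOn v (Metric.ball x r) μ := fun x r hr =>
    locallyIntegrable_of_bounded hball hv hk x hr
  have hleb : ∀ᵐ x ∂μ,
      Tendsto (fun s => ⨍ y in Metric.closedBall x s, v y ∂μ) (𝓝[>] 0) (𝓝 (v x)) := by
    have := isUnifLocDoublingMeasure_of_ball hC
    have : IsLocallyFiniteMeasure μ :=
      ⟨fun x => ⟨_, Metric.ball_mem_nhds x one_pos, (hball x 1 one_pos).2⟩⟩
    have hloc : LocallyIntegrable v μ := fun x =>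
      ⟨_, Metric.ball_mem_nhds x one_pos, hvint x 1 one_pos⟩
    filter_upwards [IsUnifLocDoublingMeasure.ae_tendsto_average μ hloc 1] with x hx
    refine hx (fun _ => x) id tendsto_id ?_
    filter_upwards [self_mem_nhdsWithin] with s hs
    simpa using le_of_lt hs
  set A : Set P := {x | x ∉ E ∧
    Tendsto (fun s => ⨍ y in Metric.closedBall x s, v y ∂μ) (𝓝[>] 0) (𝓝 (v x))} with hA
  have hlam0 : (0 : ℝ) < lam := by linarith
  have hLip : LipschitzOnWith (L₀ * σ) v A := by
    refine LipschitzOnWith.of_dist_le_mul fun x hx y hy => ?_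
    push_cast [hL₀]
    have hd : 0 ≤ dist x y := dist_nonneg
    have hσ0 : (0 : ℝ) ≤ σ := σ.coe_nonneg
    rcases le_total (4 * dist x y) (1 / lam) with hxy | hxy
    · have h := dist_le_of_maximal_le (μ := μ) (M := 4 * c * σ) hC1 hC hball hvint hxy
        (fun z hz ρ hρ hρR => by
          have hzE : z ∉ E := by
            rcases hz with rfl | rfl
            · exact hx.1
            · exact hy.1
          refine (laverage_edist_le hlam hPI hball hv hk hg (hgood z hzE) hρ ?_).trans_eq ?_
          · rwa [le_div_iff₀ hlam0, mul_comm] at hρR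
          · rw [← ENNReal.ofReal_coe_nnreal (p := c), ← ENNReal.ofReal_coe_nnreal (p := 2 * σ),
              ← ENNReal.ofReal_mul c.coe_nonneg, ← ENNReal.ofReal_mul (by positivity)]
            congr 1
            push_cast
            ring)
        (fun z hz => by
          rcases hz with rfl | rfl
          · exact hx.2
          · exact hy.2)
      push_cast at h
      have : 0 ≤ 8 * lam * σ * dist x y := by positivity
      linarith
    · rw [div_le_iff₀ hlam0] at hxy
      have hkσ : (k : ℝ) ≤ σ := by exact_mod_cast hσ
      have h1 : dist (v x) (v y) ≤ 2 * σ := by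
        rw [Real.dist_eq]
        have := abs_sub (v x) (v y)
        linarith [hk x, hk y]
      have h2 : 2 * (σ : ℝ) ≤ 8 * lam * σ * dist x y := by nlinarith
      have : 0 ≤ 96 * (C : ℝ) ^ 3 * c * σ * dist x y := by positivity
      linarith
  obtain ⟨f₀, hf₀, hf₀v⟩ := hLip.extend_real
  have hk0 : (0 : ℝ) ≤ k := k.coe_nonneg
  have hf : LipschitzWith (L₀ * σ) fun x => max (min (f₀ x) k) (-k) :=
    (hf₀.min_const _).max_const _
  set f : P → ℝ := fun x => max (min (f₀ x) k) (-k) with hfdef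
  have hfk : ∀ x, |f x| ≤ k := fun x =>
    abs_le.2 ⟨le_max_right _ _, max_le (min_le_right _ _) (by linarith)⟩
  have hfv : ∀ x ∈ A, f x = v x := by
    intro x hx
    have := abs_le.1 (hk x)
    rw [hfdef]
    simp only
    rw [← hf₀v hx, min_eq_left this.2, max_eq_left this.1]
  have hzero : ∀ᵐ x ∂μ, x ∉ E → (v x : EReal) - f x = 0 := by
    filter_upwards [hleb] with x hx hxE
    rw [hfv x ⟨hxE, hx⟩, ← EReal.coe_sub, sub_self, EReal.coe_zero]
  have hwm : AEMeasurable (fun x => (v x : EReal) - f x) μ := by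
    simp only [← EReal.coe_sub]
    exact (hv.sub hf.continuous.measurable.aemeasurable).coe_real_ereal
  have hχ : AEMeasurable (E.indicator (1 : P → ℝ≥0∞)) μ := aemeasurable_indicator_one hEm
  have hnw : N (fun x => (v x : EReal) - f x) ≤ (2 * σ : ℝ≥0) * posNorm N (E.indicator 1) := by
    rw [norm_eq_posNorm_abs hLat hwm, ← posNorm_const_mul hLat hχ]
    refine posNorm_mono hLat (measurable_ereal_abs.comp_aemeasurable hwm) (hχ.const_mul _) ?_
    filter_upwards [hzero] with x hx
    by_cases hxE : x ∈ E
    · rw [indicator_of_mem hxE, Pi.one_apply, mul_one, ← EReal.coe_sub, EReal.abs_def]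
      refine ENNReal.ofReal_le_of_le_toReal ?_
      have := abs_sub (v x) (f x)
      have hkσ : (k : ℝ) ≤ σ := by exact_mod_cast hσ
      rw [ENNReal.coe_toReal]
      push_cast
      linarith [hk x, hfk x]
    · simp [hx hxE]
  have hgrad : posNorm N (E.indicator fun x => g x + (L₀ * σ : ℝ≥0)) ≤
      posNorm N g₁ + (σ + L₀ * σ : ℝ≥0) * posNorm N (E.indicator 1) := by
    rw [← posNorm_const_mul hLat hχ]
    refine le_trans (posNorm_mono hLat ((hgm.add measurable_const).indicator hEm).aemeasurable
      (hg₁m.aemeasurable.add (hχ.const_mul _)) (Eventually.of_forall fun x => ?_))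
      (posNorm_add_le hLat hg₁m.aemeasurable (hχ.const_mul _))
    by_cases hxE : x ∈ E
    · simp only [indicator_of_mem hxE, Pi.one_apply, mul_one, Pi.add_apply]
      refine (add_le_add_left (hgg₁ x) _).trans_eq ?_
      push_cast
      ring
    · simp [hxE]
  refine ⟨f, L₀ * σ, hf, ?_⟩
  refine (newtonianNorm_le_of_ae_eq_zero hLat (hg.sub_lipschitz hf) hgm hgfin
    hEm.nullMeasurableSet hzero).trans ((add_le_add hnw hgrad).trans ?_)
  calc (2 * σ : ℝ≥0) * posNorm N (E.indicator 1) +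
        (posNorm N g₁ + (σ + L₀ * σ : ℝ≥0) * posNorm N (E.indicator 1))
      = posNorm N g₁ + (3 + L₀ : ℝ≥0) * (σ * posNorm N (E.indicator 1)) := by
        push_cast
        ring
    _ ≤ posNorm N g₁ + (3 + L₀ : ℝ≥0) * (⌈C ^ 3⌉₊ * (8 * posNorm N g₁)) := by
        gcongr
    _ = _ := by
        push_cast
        ring

end Density

end NewtonianLip

theorem mainTheorem2 {P : Type*} [MetricSpace P] [MeasurableSpace P] [BorelSpace P]
    (μ : Measure P) [NullSingletonClass μ]
    (hball : ∀ (x : P) (r : ℝ), 0 < r → 0 < μ (Metric.ball x r) ∧ μ (Metric.ball x r) < ∞)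
    (hdoubling : NewtonianLip.IsDoubling μ)
    (hPI : NewtonianLip.SupportsPoincare μ 1)
    (N : (P → EReal) → ℝ≥0∞)
    (hX : NewtonianLip.IsRearrangementInvariantSpace μ N)
    (hAC : NewtonianLip.HasAbsolutelyContinuousNorm μ N) :
    ∀ u ∈ NewtonianLip.newtonianSpace μ N, ∀ ε : ℝ≥0∞, 0 < ε →
      ∃ f : P → ℝ, (∃ K : ℝ≥0, LipschitzWith K f) ∧
        (fun x => (f x : EReal)) ∈ NewtonianLip.newtonianSpace μ N ∧
        NewtonianLip.newtonianNorm N (fun x => u x - (f x : EReal)) < ε := by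
  rintro u ⟨hu, hufin⟩ ε hε
  have hLat := hX.toIsBanachFunctionLattice
  have hsc := NewtonianLip.secondCountable_of_measure_ball hball
  obtain ⟨C, hC1, hC⟩ := hdoubling
  obtain ⟨c, lam, -, hlam, hPI⟩ := hPI
  lift lam to ℝ≥0 using by linarith
  obtain ⟨hNu, hgrad⟩ := ENNReal.add_lt_top.1 hufin
  simp only [iInf_lt_iff] at hgrad
  obtain ⟨g, hg, hgfin⟩ := hgrad
  have hε2 : 0 < ε / 2 := ENNReal.half_pos hε.ne'
  obtain ⟨n, hn⟩ := ((NewtonianLip.tendsto_newtonianNorm_sub_clamp hX.toIsBanachFunctionSpace hAC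
    hball hu hNu hg hgfin).eventually (gt_mem_nhds hε2)).exists
  have hn0 : (0 : ℝ) ≤ n := n.cast_nonneg
  set v : P → ℝ := fun x => NewtonianLip.clamp n (u x) with hvdef
  have hv : AEMeasurable v μ := (NewtonianLip.measurable_clamp n).comp_aemeasurable hu
  have hvk : ∀ x, |v x| ≤ (n : ℝ≥0) := fun x => by
    simpa using NewtonianLip.abs_clamp_le hn0 (u x)
  have hvg : NewtonianLip.IsUpperGradient (fun x => (v x : EReal)) g :=
    hg.of_abs_sub_le fun x y => NewtonianLip.abs_clamp_sub_clamp_le _ _ _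
  have hvfin : NewtonianLip.newtonianNorm N (fun x => (v x : EReal)) < ∞ := by
    refine ENNReal.add_lt_top.2 ⟨lt_of_le_of_lt ?_ hNu, (iInf₂_le g hvg).trans_lt hgfin⟩
    exact hLat.lattice _ _ hv.coe_real_ereal hu
      (Eventually.of_forall fun x => NewtonianLip.abs_clamp_le_abs hn0 _)
  set A : ℝ≥0 := 1 + (3 + (96 * C ^ 3 * c + 8 * lam)) * (⌈C ^ 3⌉₊ * 8) with hA
  have hlim : Tendsto (fun m : ℕ => (A : ℝ≥0∞) *
      NewtonianLip.posNorm N ({x | (m : ℝ≥0∞) < g x}.indicator g)) atTop (𝓝 0) := by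
    have := ENNReal.Tendsto.const_mul (a := (A : ℝ≥0∞))
      (NewtonianLip.tendsto_posNorm_indicator_lt hX.toIsBanachFunctionSpace hAC hball
        hg.measurable.aemeasurable hgfin hg.measurable.aemeasurable hgfin)
      (Or.inr ENNReal.coe_ne_top)
    simpa using this
  obtain ⟨m, hm, hnm⟩ := ((hlim.eventually (gt_mem_nhds
    (lt_min hε2 ENNReal.zero_lt_top))).and (eventually_ge_atTop n)).exists
  obtain ⟨f, L, hf, hfv⟩ := NewtonianLip.exists_lipschitz_newtonianNorm_sub_le hX hball hC1 hC hlam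
    hPI hv hvk hvg hgfin (σ := (m : ℝ≥0)) (by exact_mod_cast hnm)
  rw [ENNReal.coe_natCast] at hfv
  have hvf := hfv.trans_lt hm
  have hfm : AEMeasurable f μ := hf.continuous.measurable.aemeasurable
  have hvfm : AEMeasurable (fun x => (v x : EReal) - f x) μ := by
    simp only [← EReal.coe_sub]
    exact (hv.sub hfm).coe_real_ereal
  refine ⟨f, ⟨L, hf⟩, ⟨hfm.coe_real_ereal, ?_⟩, ?_⟩
  · refine (NewtonianLip.newtonianNorm_add_le hLat hv.coe_real_ereal hvfm hfm.coe_real_ereal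
      (fun x => ?_) (fun x y => ?_)).trans_lt (ENNReal.add_lt_top.2
        ⟨hvfin, hvf.trans_le (min_le_right _ _)⟩)
    · rw [← EReal.coe_sub, EReal.abs_def, EReal.abs_def, EReal.abs_def,
        ← ENNReal.ofReal_add (abs_nonneg _) (abs_nonneg _)]
      exact ENNReal.ofReal_le_ofReal (by grind)
    · simp only [← EReal.coe_sub, EReal.abs_def]
      rw [← ENNReal.ofReal_add (abs_nonneg _) (abs_nonneg _)]
      exact ENNReal.ofReal_le_ofReal (by grind)
  · have hfin : ∀ (a : EReal) (b c : ℝ), (a - c).abs ≤ (a - b).abs + ((b : EReal) - c).abs := by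
      intro a b c
      induction a with
      | bot => simp
      | top => simp
      | coe a =>
        simp only [← EReal.coe_sub, EReal.abs_def]
        rw [← ENNReal.ofReal_add (abs_nonneg _) (abs_nonneg _)]
        exact ENNReal.ofReal_le_ofReal (abs_sub_le _ _ _)
    have huvm : AEMeasurable (fun x => u x - v x) μ := by
      simp only [sub_eq_add_neg, ← EReal.coe_neg]
      exact hu.add hv.neg.coe_real_ereal
    have hufm : AEMeasurable (fun x => u x - f x) μ := by
      simp only [sub_eq_add_neg, ← EReal.coe_neg]
      exact hu.add hfm.neg.coe_real_ereal
    refine (NewtonianLip.newtonianNorm_add_le hLat huvm hvfm hufm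
      (fun x => hfin _ _ _) (fun x y => ?_)).trans_lt ((ENNReal.add_lt_add hn
        (hvf.trans_le (min_le_left _ _))).trans_eq (ENNReal.add_halves ε))
    by_cases h : (u x - v x - (u y - v y)).abs < ∞
    · have hreal : ∀ (a : EReal) (b : ℝ), a - b = (a - b).toReal → a = a.toReal := by
        intro a b
        induction a <;> simp
      obtain ⟨h1, h2⟩ := NewtonianLip.ereal_abs_sub_lt_top h
      rw [hreal _ _ h1, hreal _ _ h2]
      simp only [← EReal.coe_sub, EReal.abs_def]
      rw [← ENNReal.ofReal_add (abs_nonneg _) (abs_nonneg _)]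
      exact ENNReal.ofReal_le_ofReal (by grind)
    · rw [not_lt_top_iff.1 h, top_add]
      exact le_top
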